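/- Let $\mathbb T^2=(\mathbb R/\mathbb Z)^2$ with Lebesgue measure, $\widehat f(n)=\int_{\mathbb T^2}f(x)e^{-2\pi i n\cdot x}\,dx$ for $n\in\mathbb Z^2$, and $\langle\xi\rangle=(1+|\xi|^2)^{1/2}$ for $\xi\in\mathbb R^2$. For a distribution $u$ on $\mathbb T^2$ let $\langle\nabla\rangle^s u=(1-\Delta)^{s/2}u$ be the distribution with Fourier coefficients $\langle 2\pi n\rangle^s\,\widehat u(n)$. Fix a smooth $\phi:\mathbb R\to[0,1]$ supported on $[-\frac85,\frac85]$ with $\phi=1$ on $[-\frac54,\frac54]$; put $\phi_0(\xi)=\phi(|\xi|)$ and $\phi_j(\xi)=\phi_0(2^{-j}\xi)-\phi_0(2^{-j+1}\xi)$ for $j\ge1$, let $P_{2^j}$ be the Fourier multiplier with symbol $\phi_j/\sum_{\ell\ge0}\phi_\ell$, i.e. $$P_{2^j}u(x)=\sum_{n\in\mathbb Z^2}\frac{\phi_j(n)}{\sum_{\ell\ge0}\phi_\ell(n)}\,\widehat u(n)\,e^{2\pi i n\cdot x},$$ and let $C^\alpha(\mathbb T^2)=B^\alpha_{\infty,\infty}(\mathbb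 T^2)$ be the space of distributions $u$ with $$\|u\|_{C^\alpha}=\sup_{j\ge0}\,2^{j\alpha}\,\|P_{2^j}u\|_{L^\infty(\mathbb T^2)}<\infty .$$ **Proposition (commutator estimate).** Let $s>0$ and $0<\varepsilon<\frac14\min(s,1)$. There is a constant $C$, depending only on $s$, $\varepsilon$ (and the choice of $\phi$), such that for every (complex-valued) $u\in C^{s-\varepsilon}(\mathbb T^2)$ $$\big\|\langle\nabla\rangle^s(u^3)-3u^2\langle\nabla\rangle^s u\big\|_{L^2(\mathbb T^2)}\le C\,\|u\|_{C^{s-\varepsilon}(\mathbb T^2)}^3 .$$ Here $u$ is a continuous function, $u^2$ and $u^3$ are its pointwise powers, and $u^2\langle\nabla\rangle^s u$ is the product of the function $u^2$ with the distribution $\langle\nabla\rangle^s u$, whose Fourier coefficients are the absolutely convergent sums $\sum_{k\in\mathbb Z^2}\widehat{u^2}(n-k)\,\langle2\pi k\rangle^s\,\widehat u(k)$; in particular the claim includes that $u$ is continuous, that these sums converge absolutely, and that $\langle\nabla\rangle^s(u^3)-3u^2\langle\nabla\rangle^s u$ is a function in $L^2(\mathbb T^2)$. -/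

import Mathlib

open MeasureTheory
open scoped ENNReal NNReal ContDiff

noncomputable section

/-- The two-dimensional torus `𝕋² = (ℝ/ℤ)²`. -/
abbrev Torus2 : Type := UnitAddTorus (Fin 2)

/-- Lebesgue (= Haar probability) measure on `𝕋²`; this is the measure with respect to which
Mathlib's Fourier coefficients `UnitAddTorus.mFourierCoeff` are defined. -/
def torusMeasure : Measure Torus2 := Measure.pi fun _ => AddCircle.haarAddCircle

/-- A frequency `n ∈ ℤ²` seen as a vector of `ℝ²` with the Euclidean norm. -/
def freq (n : Fin 2 → ℤ) : EuclideanSpace ℝ (Fin 2) := WithLp.toLp 2 fun i => (n i : ℝ)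

/-- The Japanese bracket `⟨ξ⟩ = (1 + |ξ|²)^{1/2}`. -/
def japaneseBracket (ξ : EuclideanSpace ℝ (Fin 2)) : ℝ := Real.sqrt (1 + ‖ξ‖ ^ 2)

theorem one_le_japaneseBracket (ξ : EuclideanSpace ℝ (Fin 2)) : 1 ≤ japaneseBracket ξ := by
  rw [japaneseBracket, Real.one_le_sqrt]
  nlinarith [sq_nonneg ‖ξ‖]

/-- Distributions on `𝕋²`, given by their Fourier coefficients `û : ℤ² → ℂ`: these are exactly the
families of at most polynomial growth. -/
def TorusDistribution : Submodule ℂ ((Fin 2 → ℤ) → ℂ) where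
  carrier := {a | ∃ (C : ℝ) (k : ℕ), ∀ n, ‖a n‖ ≤ C * japaneseBracket (freq n) ^ k}
  zero_mem' := ⟨0, 0, fun n => by simp⟩
  add_mem' := by
    rintro a b ⟨C, k, ha⟩ ⟨D, l, hb⟩
    refine ⟨|C| + |D|, k + l, fun n => ?_⟩
    have h1 := one_le_japaneseBracket (freq n)
    have hk : japaneseBracket (freq n) ^ k ≤ japaneseBracket (freq n) ^ (k + l) :=
      pow_le_pow_right₀ h1 (by omega)
    have hl : japaneseBracket (freq n) ^ l ≤ japaneseBracket (freq n) ^ (k + l) :=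
      pow_le_pow_right₀ h1 (by omega)
    calc ‖(a + b) n‖ ≤ ‖a n‖ + ‖b n‖ := norm_add_le _ _
      _ ≤ C * japaneseBracket (freq n) ^ k + D * japaneseBracket (freq n) ^ l :=
          add_le_add (ha n) (hb n)
      _ ≤ |C| * japaneseBracket (freq n) ^ (k + l) + |D| * japaneseBracket (freq n) ^ (k + l) := by
          gcongr
          · exact le_abs_self C
          · exact le_abs_self D
      _ = (|C| + |D|) * japaneseBracket (freq n) ^ (k + l) := by ring
  smul_mem' := by
    rintro c a ⟨C, k, ha⟩
    refine ⟨‖c‖ * C, k, fun n => ?_⟩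
    rw [Pi.smul_apply, norm_smul, mul_assoc]
    exact mul_le_mul_of_nonneg_left (ha n) (norm_nonneg c)

/-- The Fourier coefficient `û(n)` of a distribution. -/
def distCoeff (u : TorusDistribution) (n : Fin 2 → ℤ) : ℂ := u.1 n

/-- The distribution on `𝕋²` defined by a continuous function `f`, with
`f̂(n) = ∫ f(x) e^{-2πi n·x} dx`. -/
def ofContinuous (f : C(Torus2, ℂ)) : TorusDistribution :=
  ⟨fun n => UnitAddTorus.mFourierCoeff f n, ‖f‖, 0, fun n => by
    have h : ∀ t : Torus2, ‖UnitAddTorus.mFourier (-n) t • f t‖ ≤ ‖f‖ := fun t => by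
      rw [norm_smul]
      have h1 : ‖UnitAddTorus.mFourier (-n) t‖ ≤ 1 :=
        ((UnitAddTorus.mFourier (-n)).norm_coe_le_norm t).trans UnitAddTorus.mFourier_norm.le
      calc _ ≤ 1 * ‖f‖ := by
            gcongr
            exact f.norm_coe_le_norm t
        _ = ‖f‖ := one_mul _
    have h2 : ‖∫ t, UnitAddTorus.mFourier (-n) t • f t ∂torusMeasure‖ ≤ ‖f‖ := by
      have : IsProbabilityMeasure torusMeasure := by unfold torusMeasure; infer_instance
      simpa using norm_integral_le_of_norm_le_const (μ := torusMeasure)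
        (Filter.Eventually.of_forall h)
    have h3 : UnitAddTorus.mFourierCoeff f n =
        ∫ t, UnitAddTorus.mFourier (-n) t • f t ∂torusMeasure := rfl
    rw [pow_zero, mul_one]
    exact (congrArg norm h3).trans_le h2⟩

theorem japaneseBracket_two_pi_rpow_le (s : ℝ) (ξ : EuclideanSpace ℝ (Fin 2)) :
    japaneseBracket ((2 * Real.pi) • ξ) ^ s ≤
      (2 * Real.pi) ^ ⌈|s|⌉₊ * japaneseBracket ξ ^ ⌈|s|⌉₊ := by
  have hpi : (1 : ℝ) ≤ 2 * Real.pi := by linarith [Real.pi_gt_three]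
  have h1 := one_le_japaneseBracket ((2 * Real.pi) • ξ)
  have h2 : japaneseBracket ((2 * Real.pi) • ξ) ≤ 2 * Real.pi * japaneseBracket ξ := by
    unfold japaneseBracket
    rw [norm_smul, Real.norm_of_nonneg (by linarith)]
    apply Real.sqrt_le_iff.2
    refine ⟨by positivity, ?_⟩
    rw [mul_pow, mul_pow (2 * Real.pi) (Real.sqrt _), Real.sq_sqrt (by positivity)]
    nlinarith [one_le_pow₀ hpi (n := 2)]
  calc japaneseBracket ((2 * Real.pi) • ξ) ^ s
      ≤ japaneseBracket ((2 * Real.pi) • ξ) ^ (⌈|s|⌉₊ : ℝ) :=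
        Real.rpow_le_rpow_of_exponent_le h1 ((le_abs_self s).trans (Nat.le_ceil _))
    _ = japaneseBracket ((2 * Real.pi) • ξ) ^ ⌈|s|⌉₊ := Real.rpow_natCast _ _
    _ ≤ (2 * Real.pi * japaneseBracket ξ) ^ ⌈|s|⌉₊ := pow_le_pow_left₀ (by linarith) h2 _
    _ = _ := mul_pow _ _ _

/-- The operator `⟨∇⟩^s = (1 - Δ)^{s/2}` on distributions, that is, the Fourier multiplier with
symbol `⟨2πn⟩^s`. -/
def bracketNabla (s : ℝ) (u : TorusDistribution) : TorusDistribution :=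
  ⟨fun n => ((japaneseBracket ((2 * Real.pi) • freq n) ^ s : ℝ) : ℂ) * distCoeff u n, by
    obtain ⟨C, k, hu⟩ := u.2
    refine ⟨(2 * Real.pi) ^ ⌈|s|⌉₊ * C, ⌈|s|⌉₊ + k, fun n => ?_⟩
    have h0 := one_le_japaneseBracket ((2 * Real.pi) • freq n)
    have h1 := one_le_japaneseBracket (freq n)
    rw [norm_mul, Complex.norm_real, Real.norm_of_nonneg (by positivity)]
    calc _ ≤ ((2 * Real.pi) ^ ⌈|s|⌉₊ * japaneseBracket (freq n) ^ ⌈|s|⌉₊) *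
          (C * japaneseBracket (freq n) ^ k) := by
          apply mul_le_mul (japaneseBracket_two_pi_rpow_le s _) (hu n) (norm_nonneg _)
          positivity
      _ = _ := by ring⟩

/-- `h` is the product `f g` of the distributions `f` and `g`: for every `n` the convolution
`∑ₖ f̂(n - k) ĝ(k)` converges absolutely (unconditional and absolute convergence agree in `ℂ`) and
its sum is `ĥ(n)`. -/
def IsProduct (f g h : TorusDistribution) : Prop :=
  ∀ n, HasSum (fun k => distCoeff f (n - k) * distCoeff g k) (distCoeff h n)

/-- A smooth bump function `φ : ℝ → [0,1]`, supported on `[-8/5, 8/5]` and equal to `1` on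
`[-5/4, 5/4]`. -/
structure IsLPBump (φ : ℝ → ℝ) : Prop where
  smooth : ContDiff ℝ ∞ φ
  mem_Icc : ∀ r, φ r ∈ Set.Icc (0 : ℝ) 1
  support : tsupport φ ⊆ Set.Icc (-(8 / 5)) (8 / 5)
  eq_one : ∀ r ∈ Set.Icc (-(5 / 4) : ℝ) (5 / 4), φ r = 1

/-- `φ₀(ξ) = φ(|ξ|)` and `φⱼ(ξ) = φ₀(2^{-j} ξ) - φ₀(2^{-j+1} ξ)` for `j ≥ 1`. -/
def lpBump (φ : ℝ → ℝ) : ℕ → EuclideanSpace ℝ (Fin 2) → ℝ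
  | 0, ξ => φ ‖ξ‖
  | j + 1, ξ => φ ‖((2 : ℝ) ^ (j + 1))⁻¹ • ξ‖ - φ ‖((2 : ℝ) ^ j)⁻¹ • ξ‖

/-- The symbol of the Littlewood–Paley projector `P_N`, `N = 2^j`. -/
def lpSymbol (φ : ℝ → ℝ) (j : ℕ) (ξ : EuclideanSpace ℝ (Fin 2)) : ℝ :=
  lpBump φ j ξ / ∑' l, lpBump φ l ξ

/-- The trigonometric polynomial `P_N u`, `N = 2^j`. The sum has only finitely many non-zero
terms when `φ` has bounded support. -/
def lpProj (φ : ℝ → ℝ) (j : ℕ) (u : TorusDistribution) (x : Torus2) : ℂ :=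
  ∑' n : Fin 2 → ℤ, (lpSymbol φ j (freq n) : ℂ) * distCoeff u n * UnitAddTorus.mFourier n x

/-- The norm of the Besov–Hölder space `C^α(𝕋²) = B^α_{∞,∞}(𝕋²)`,
`‖u‖_{C^α} = sup_{N = 2^j} N^α ‖P_N u‖_{L^∞}`, with value `∞` when `u ∉ C^α(𝕋²)`. -/
def besovHolderNorm (φ : ℝ → ℝ) (α : ℝ) (u : TorusDistribution) : ℝ≥0∞ :=
  ⨆ j : ℕ, ENNReal.ofReal (((2 : ℝ) ^ j) ^ α) * eLpNorm (lpProj φ j u) ⊤ torusMeasure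

end

open UnitAddTorus ProbabilityTheory

/-! Write `Λ = ⟨∇⟩^s` and `α = s - ε`. The Littlewood–Paley blocks of `u` are trigonometric
polynomials of degree `≲ 2^j` and sup norm `≲ 2^{-jα}`, so they sum uniformly to a continuous `U`.
This gives two kinds of regularity, each for exponents strictly below `α`: Hölder continuity up to
exponent 1, by Bernstein (`DyadicSum.holder`), and weighted `ℓ²` bounds on the Fourier coefficients,
by Parseval (`DyadicSum.sqSumLE`). The square `U²` is a dyadic sum of the same kind
(`DyadicSum.exists_sq`), so Cauchy–Schwarz with `s/2 < α` derivatives on each factor makes `u² Λu`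
absolutely convergent on the Fourier side. The commutator is then bounded by one of two arguments,
according to the size of `s`.

For `s ≤ 8/5`, subordination gives `c Λ = ∫₀^∞ (1 - P_t) t^{-1-s/2} dt` with `P_t = e^{-t(1-Δ)}`, a
Gaussian average damped by `e^{-t}`. The identity `a³ - b³ - 3a²(a - b) = -(a - b)²(2a + b)` shows
that the commutator of `1 - P_t` is quadratic in the increments of `U`. If `U` is `β`-Hölder it is
therefore `O(min(1, t^β))`, and the integral converges as soon as `β > s/2`. This even gives a bound
in `L^∞` (`exists_commutator_of_holder`).

For `s ≥ 8/5`, the commutator splits as `Λ(u³) - 3u²Λu = [Λ(u²·u) - Λ(u²)u - u²Λu] + [Λ(u²) -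
2uΛu]u`. Each bracket is a bilinear form with symbol `⟨m+n⟩^s - ⟨m⟩^s - ⟨n⟩^s`, which is at most a
constant times `⟨m⟩^r⟨n⟩^{s-r} + ⟨m⟩^{s-r}⟨n⟩^r` when `r ≥ s - 1`. Young's inequality `ℓ² * ℓ¹ ⊆ ℓ²`
finishes (`sqSumLE_cubic_commutator`). -/

instance instIsProbabilityMeasureTorusMeasure : IsProbabilityMeasure torusMeasure := by
  unfold torusMeasure; infer_instance

instance instIsAddHaarMeasureTorusMeasure : torusMeasure.IsAddHaarMeasure := by
  unfold torusMeasure; infer_instance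

/-! ### Fourier coefficients of continuous functions on the torus. -/

theorem mFourierCoeff_eq_integral_torusMeasure (f : Torus2 → ℂ) (n : Fin 2 → ℤ) :
    mFourierCoeff f n = ∫ t, mFourier (-n) t * f t ∂torusMeasure := rfl

theorem norm_mFourier_apply (n : Fin 2 → ℤ) (x : Torus2) : ‖mFourier n x‖ = 1 := by
  simp only [mFourier, fourier_apply, ContinuousMap.coe_mk, norm_prod, Circle.norm_coe,
    Finset.prod_const_one]

theorem ContinuousMap.integrable_torusMeasure (f : C(Torus2, ℂ)) : Integrable f torusMeasure :=
  f.continuous.integrable_of_hasCompactSupport (HasCompactSupport.of_compactSpace f)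

theorem mFourierCoeff_add (f g : C(Torus2, ℂ)) (n : Fin 2 → ℤ) :
    mFourierCoeff (f + g) n = mFourierCoeff f n + mFourierCoeff g n := by
  simp only [mFourierCoeff_eq_integral_torusMeasure]
  simp only [ContinuousMap.add_apply, mul_add]
  exact integral_add (mFourier (-n) * f).integrable_torusMeasure
    (mFourier (-n) * g).integrable_torusMeasure

theorem mFourierCoeff_smul (c : ℂ) (f : C(Torus2, ℂ)) (n : Fin 2 → ℤ) :
    mFourierCoeff (c • f) n = c * mFourierCoeff f n := by
  simp only [mFourierCoeff_eq_integral_torusMeasure]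
  rw [← integral_const_mul]
  simp [mul_left_comm]

theorem norm_mFourierCoeff_le (f : C(Torus2, ℂ)) (n : Fin 2 → ℤ) :
    ‖mFourierCoeff f n‖ ≤ ‖f‖ := by
  rw [mFourierCoeff_eq_integral_torusMeasure]
  refine (norm_integral_le_of_norm_le_const (C := ‖f‖) (.of_forall fun t => ?_)).trans (by simp)
  rw [norm_mul, norm_mFourier_apply, one_mul]
  exact f.norm_coe_le_norm t

/-- The Fourier coefficient at `n` as a continuous linear functional on `C(𝕋²)`. -/
noncomputable def mFourierCoeffCLM (n : Fin 2 → ℤ) : C(Torus2, ℂ) →L[ℂ] ℂ :=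
  LinearMap.mkContinuous
    { toFun := fun f => mFourierCoeff f n
      map_add' := fun f g => mFourierCoeff_add f g n
      map_smul' := fun c f => mFourierCoeff_smul c f n } 1 fun f => by
    simpa using norm_mFourierCoeff_le f n

@[simp] theorem mFourierCoeffCLM_apply (n : Fin 2 → ℤ) (f : C(Torus2, ℂ)) :
    mFourierCoeffCLM n f = mFourierCoeff f n := rfl

theorem mFourierCoeff_mFourier (m n : Fin 2 → ℤ) :
    mFourierCoeff (mFourier m) n = if m = n then 1 else 0 := by
  have h := (orthonormal_iff_ite.1 (orthonormal_mFourier (d := Fin 2))) n m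
  rw [ContinuousMap.inner_toLp] at h
  simp only [← mFourier_neg] at h
  simp only [eq_comm (a := m)]
  rw [← h]
  refine integral_congr_ae (.of_forall fun t => ?_)
  simp [mul_comm]

theorem mFourierCoeff_toLp_torusMeasure (f : C(Torus2, ℂ)) (n : Fin 2 → ℤ) :
    mFourierCoeff (f.toLp 2 torusMeasure ℂ) n = mFourierCoeff f n :=
  mFourierCoeff_toLp f n

theorem hasSum_star_mFourierCoeff_mul (f g : C(Torus2, ℂ)) :
    HasSum (fun n => star (mFourierCoeff f n) * mFourierCoeff g n)
      (∫ t, star (f t) * g t ∂torusMeasure) := by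
  have h : HasSum (fun n => star (mFourierCoeff (f.toLp 2 torusMeasure ℂ) n) *
      mFourierCoeff (g.toLp 2 torusMeasure ℂ) n)
      (∫ t, star (f.toLp 2 torusMeasure ℂ t) * g.toLp 2 torusMeasure ℂ t ∂torusMeasure) :=
    hasSum_prod_mFourierCoeff (d := Fin 2) (f.toLp 2 torusMeasure ℂ) (g.toLp 2 torusMeasure ℂ)
  simp only [mFourierCoeff_toLp_torusMeasure] at h
  convert! h using 1
  refine integral_congr_ae ?_
  filter_upwards [ContinuousMap.coeFn_toLp (p := 2) (𝕜 := ℂ) torusMeasure f,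
    ContinuousMap.coeFn_toLp (p := 2) (𝕜 := ℂ) torusMeasure g] with t h1 h2
  rw [h1, h2]

theorem hasSum_sq_norm_mFourierCoeff (f : C(Torus2, ℂ)) :
    HasSum (fun n => ‖mFourierCoeff f n‖ ^ 2) (∫ t, ‖f t‖ ^ 2 ∂torusMeasure) := by
  have h := hasSum_star_mFourierCoeff_mul f f
  have e (z : ℂ) : star z * z = ((‖z‖ ^ 2 : ℝ) : ℂ) := by
    rw [RCLike.star_def, Complex.conj_mul']; push_cast; rfl
  simp only [e, integral_complex_ofReal] at h
  exact_mod_cast h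

theorem mFourierCoeff_star_mul_mFourier (f : C(Torus2, ℂ)) (n k : Fin 2 → ℤ) :
    mFourierCoeff (star (f * mFourier (-n)) : C(Torus2, ℂ)) k = star (mFourierCoeff f (n - k)) := by
  rw [mFourierCoeff_eq_integral_torusMeasure, mFourierCoeff_eq_integral_torusMeasure,
    RCLike.star_def, ← integral_conj]
  refine integral_congr_ae (.of_forall fun t => ?_)
  change mFourier (-k) t * star (f t * mFourier (-n) t) =
    starRingEnd ℂ (mFourier (-(n - k)) t * f t)
  rw [neg_sub, sub_eq_neg_add, add_comm, mFourier_add, mFourier_neg, mFourier_neg]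
  simp only [RCLike.star_def, map_mul, Complex.conj_conj]
  ring

/-- Parseval for the pair `conj (f e_{-n})`, `g`: conjugation reflects the coefficients of `f` to `n
- k`. Only square summability is used, so `f` and `g` may be any continuous functions. -/
theorem hasSum_mFourierCoeff_mul (f g : C(Torus2, ℂ)) (n : Fin 2 → ℤ) :
    HasSum (fun k => mFourierCoeff f (n - k) * mFourierCoeff g k) (mFourierCoeff (f * g) n) := by
  have h := hasSum_star_mFourierCoeff_mul (star (f * mFourier (-n))) g
  simp only [mFourierCoeff_star_mul_mFourier, star_star] at h
  convert! h using 1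
  rw [mFourierCoeff_eq_integral_torusMeasure]
  refine integral_congr_ae (.of_forall fun t => ?_)
  change mFourier (-n) t * (f t * g t) = star (star (f t * mFourier (-n) t)) * g t
  rw [star_star]
  ring

/-- Riesz–Fischer with its norm bound; it turns the `ℓ²` estimates for large `s` into an `L²`
function. -/
theorem exists_memLp_mFourierCoeff_eq (c : (Fin 2 → ℤ) → ℂ) {K : ℝ} (hK : 0 ≤ K)
    (hc : ∀ S : Finset (Fin 2 → ℤ), ∑ n ∈ S, ‖c n‖ ^ 2 ≤ K ^ 2) :
    ∃ g : Torus2 → ℂ, MemLp g 2 torusMeasure ∧ (∀ n, mFourierCoeff g n = c n) ∧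
      eLpNorm g 2 torusMeasure ≤ ENNReal.ofReal K := by
  have hs : Summable fun n => ‖c n‖ ^ 2 := summable_of_sum_le (fun n => by positivity) hc
  have hmem : Memℓp c 2 := by
    apply memℓp_gen
    simpa using hs
  let x : lp (fun _ : Fin 2 → ℤ => ℂ) 2 := ⟨c, hmem⟩
  let g := (mFourierBasis (d := Fin 2)).repr.symm x
  have hx : ‖x‖ ≤ K := by
    have h2 := lp.norm_rpow_eq_tsum (p := 2) (by norm_num) x
    simp only [ENNReal.toReal_ofNat, Real.rpow_ofNat] at h2
    refine le_of_sq_le_sq ?_ hK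
    rw [h2]
    exact Summable.tsum_le_of_sum_le hs hc
  have hg : ‖g‖ ≤ K := by
    simpa [g] using hx
  refine ⟨g, Lp.memLp g, fun n => ?_, ?_⟩
  · rw [← mFourierBasis_repr]
    simp [g, x]
  · have : ‖g‖ₑ = eLpNorm g 2 torusMeasure := Lp.enorm_def g
    rw [← this, ← ofReal_norm]
    exact ENNReal.ofReal_le_ofReal hg

/-! ### Square summable families with an explicit bound. -/

/-- The family `y` is square summable with `ℓ²` norm at most `K`. -/
def SqSumLE {ι : Type*} (y : ι → ℝ) (K : ℝ) : Prop :=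
  0 ≤ K ∧ ∀ S : Finset ι, ∑ i ∈ S, y i ^ 2 ≤ K ^ 2

namespace SqSumLE

variable {ι : Type*} {x y : ι → ℝ} {K L : ℝ}

/-- On a finite set of indices the condition bounds a Euclidean norm, so the triangle inequality
becomes available without any summability side condition. -/
theorem iff_norm_toLp : SqSumLE y K ↔
    0 ≤ K ∧ ∀ S : Finset ι, ‖WithLp.toLp 2 fun i : S => y i‖ ≤ K := by
  refine and_congr_right fun hK => forall_congr' fun S => ?_
  rw [EuclideanSpace.norm_eq, Real.sqrt_le_left hK]
  simp only [Real.norm_eq_abs, sq_abs]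
  rw [Finset.sum_coe_sort S fun i => y i ^ 2]

theorem mono (h : SqSumLE y K) (hx : ∀ i, |x i| ≤ y i) : SqSumLE x K :=
  ⟨h.1, fun S => (Finset.sum_le_sum fun i _ => by
    rw [← sq_abs]; exact pow_le_pow_left₀ (abs_nonneg _) (hx i) 2).trans (h.2 S)⟩

theorem mono_right (h : SqSumLE y K) (hK : K ≤ L) : SqSumLE y L :=
  ⟨h.1.trans hK, fun S => (h.2 S).trans (pow_le_pow_left₀ h.1 hK 2)⟩

theorem const_mul (h : SqSumLE y K) {c : ℝ} (hc : 0 ≤ c) : SqSumLE (fun i => c * y i) (c * K) :=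
  ⟨mul_nonneg hc h.1, fun S => by
    simp only [mul_pow]
    rw [← Finset.mul_sum]
    exact mul_le_mul_of_nonneg_left (h.2 S) (sq_nonneg c)⟩

theorem add (hx : SqSumLE x K) (hy : SqSumLE y L) : SqSumLE (fun i => x i + y i) (K + L) := by
  rw [iff_norm_toLp] at *
  exact ⟨add_nonneg hx.1 hy.1, fun S => (norm_add_le (WithLp.toLp 2 fun i : S => x i)
    (WithLp.toLp 2 fun i : S => y i)).trans (add_le_add (hx.2 S) (hy.2 S))⟩

/-- Minkowski's inequality for infinite sums, tested on finite sets of indices. -/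
theorem hasSum {κ : Type*} {X : κ → ι → ℝ} {c : κ → ℝ} {C : ℝ} (hX : ∀ j, SqSumLE (X j) (c j))
    (hc : HasSum c C) (hy : ∀ i, HasSum (fun j => X j i) (y i)) : SqSumLE y C := by
  simp only [iff_norm_toLp] at *
  refine ⟨hc.nonneg fun j => (hX j).1, fun S => ?_⟩
  have h : HasSum (fun j => WithLp.toLp 2 fun i : S => X j i) (WithLp.toLp 2 fun i : S => y i) :=
    (PiLp.continuousLinearEquiv 2 ℝ fun _ : S => ℝ).symm.hasSum (f := fun j (i : S) => X j i)
      |>.2 (Pi.hasSum.2 fun i => hy i)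
  rw [← h.tsum_eq]
  exact tsum_of_norm_bounded hc fun j => (hX j).2 S

theorem comp_injective (h : SqSumLE y K) {κ : Type*} {e : κ → ι} (he : e.Injective) :
    SqSumLE (fun j => y (e j)) K :=
  ⟨h.1, fun S => by simpa using h.2 (S.map ⟨e, he⟩)⟩

theorem le (h : SqSumLE y K) (i : ι) : |y i| ≤ K :=
  abs_le_of_sq_le_sq (by simpa using h.2 {i}) h.1

theorem of_hasSum {T : ℝ} (h : HasSum (fun i => y i ^ 2) T) (hK : 0 ≤ K) (hT : T ≤ K ^ 2) :
    SqSumLE y K :=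
  ⟨hK, fun S => (sum_le_hasSum S (fun _ _ => sq_nonneg _) h).trans hT⟩

theorem of_summable (h : Summable fun i => y i ^ 2) : SqSumLE y √(∑' i, y i ^ 2) :=
  of_hasSum h.hasSum (Real.sqrt_nonneg _)
    (Real.sq_sqrt (tsum_nonneg fun _ => sq_nonneg _)).ge

theorem sum_mul_le (hx : SqSumLE x K) (hy : SqSumLE y L) (S : Finset ι) :
    ∑ i ∈ S, |x i| * |y i| ≤ K * L := by
  refine abs_le_of_sq_le_sq' ?_ (mul_nonneg hx.1 hy.1) |>.2
  refine (Finset.sum_mul_sq_le_sq_mul_sq S _ _).trans ?_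
  simp only [sq_abs, mul_pow]
  exact mul_le_mul (hx.2 S) (hy.2 S) (Finset.sum_nonneg fun _ _ => sq_nonneg _) (sq_nonneg _)

theorem summable_mul (hx : SqSumLE x K) (hy : SqSumLE y L) : Summable fun i => x i * y i := by
  rw [← summable_abs_iff]
  simp only [abs_mul]
  exact summable_of_sum_le (fun i => by positivity) (hx.sum_mul_le hy)

theorem tsum_mul_le (hx : SqSumLE x K) (hy : SqSumLE y L) : ∑' i, x i * y i ≤ K * L := by
  refine (hx.summable_mul hy).tsum_le_of_sum_le fun S =>
    (Finset.sum_le_sum fun i _ => ?_).trans (hx.sum_mul_le hy S)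
  rw [← abs_mul]
  exact le_abs_self _

end SqSumLE

theorem summable_conv {G : Type*} [AddCommGroup G] {p q : G → ℝ} {K : ℝ} (hp : SqSumLE p K)
    (hq : ∀ k, 0 ≤ q k) (hqs : Summable q) (n : G) : Summable fun k => p (n - k) * q k :=
  (hqs.mul_left K).of_norm_bounded fun k => by
    rw [norm_mul, Real.norm_of_nonneg (hq k)]
    exact mul_le_mul_of_nonneg_right (hp.le _) (hq k)

/-- Young's inequality `‖p * q‖_{ℓ²} ≤ ‖p‖_{ℓ²} ‖q‖_{ℓ¹}`. -/
theorem SqSumLE.conv {G : Type*} [AddCommGroup G] {p q : G → ℝ} {K L : ℝ} (hp : SqSumLE p K)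
    (hq : ∀ k, 0 ≤ q k) (hqs : HasSum q L) :
    SqSumLE (fun n => ∑' k, p (n - k) * q k) (K * L) := by
  -- The convolution is a superposition of translates of `p`, the `k`-th having norm at most `K * q
  -- k`.
  refine SqSumLE.hasSum (X := fun k n => p (n - k) * q k) (c := fun k => K * q k) (fun k => ?_)
    (hqs.mul_left K) fun n => (summable_conv hp hq hqs.summable n).hasSum
  have := (hp.comp_injective (e := fun n => n - k) (sub_left_injective)).const_mul (hq k)
  simpa only [mul_comm] using this

/-! ### The weight and the symbol of the bilinear commutator. -/

/-- The weight `⟨2πn⟩`. -/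
noncomputable def weight (n : Fin 2 → ℤ) : ℝ := japaneseBracket ((2 * Real.pi) • freq n)

theorem one_le_weight (n : Fin 2 → ℤ) : 1 ≤ weight n := one_le_japaneseBracket _

theorem weight_pos (n : Fin 2 → ℤ) : 0 < weight n := one_pos.trans_le (one_le_weight n)

theorem weight_rpow_pos (n : Fin 2 → ℤ) (s : ℝ) : 0 < weight n ^ s :=
  Real.rpow_pos_of_pos (weight_pos n) s

theorem japaneseBracket_add_le (x y : EuclideanSpace ℝ (Fin 2)) :
    japaneseBracket (x + y) ≤ japaneseBracket x + japaneseBracket y := by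
  have hx := one_le_japaneseBracket x
  have hy := one_le_japaneseBracket y
  have h1 : japaneseBracket x ^ 2 = 1 + ‖x‖ ^ 2 := Real.sq_sqrt (by positivity)
  have h2 : japaneseBracket y ^ 2 = 1 + ‖y‖ ^ 2 := Real.sq_sqrt (by positivity)
  have h3 : ‖x‖ ≤ japaneseBracket x := abs_le_of_sq_le_sq' (by linarith) (by linarith) |>.2
  have h4 : ‖y‖ ≤ japaneseBracket y := abs_le_of_sq_le_sq' (by linarith) (by linarith) |>.2
  have h5 := norm_add_le x y
  rw [japaneseBracket, Real.sqrt_le_left (by linarith)]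
  nlinarith [pow_le_pow_left₀ (norm_nonneg _) h5 2, mul_le_mul h3 h4 (norm_nonneg y) (by linarith)]

theorem freq_add (m n : Fin 2 → ℤ) : freq (m + n) = freq m + freq n := by
  ext i; simp [freq]

theorem freq_neg (n : Fin 2 → ℤ) : freq (-n) = -freq n := by
  ext i; simp [freq]

theorem weight_neg (n : Fin 2 → ℤ) : weight (-n) = weight n := by
  simp [weight, japaneseBracket, freq_neg]

theorem weight_add_le (m n : Fin 2 → ℤ) : weight (m + n) ≤ weight m + weight n := by
  rw [weight, freq_add, smul_add]
  exact japaneseBracket_add_le _ _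

theorem abs_weight_add_sub_le (m n : Fin 2 → ℤ) : |weight (m + n) - weight m| ≤ weight n := by
  rw [abs_sub_le_iff]
  have h1 := weight_add_le m n
  have h2 := weight_add_le (m + n) (-n)
  rw [add_neg_cancel_right, weight_neg] at h2
  constructor <;> linarith

theorem weight_add_le_mul (m n : Fin 2 → ℤ) : weight (m + n) ≤ 2 * (weight m * weight n) := by
  nlinarith [weight_add_le m n, one_le_weight m, one_le_weight n]

/-- Peetre's inequality: powers of the weight can be moved from `k` to `n` and `n - k`. -/
theorem weight_rpow_le (k n : Fin 2 → ℤ) {q : ℝ} (hq : 0 ≤ q) :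
    weight k ^ q ≤ 2 ^ q * (weight n ^ q * weight (n - k) ^ q) := by
  have h := weight_add_le_mul n (-(n - k))
  rw [weight_neg, neg_sub, add_sub_cancel] at h
  refine (Real.rpow_le_rpow (weight_pos k).le h hq).trans_eq ?_
  rw [Real.mul_rpow (by norm_num) (mul_pos (weight_pos _) (weight_pos _)).le,
    Real.mul_rpow (weight_pos _).le (weight_pos _).le]

theorem weight_sq (n : Fin 2 → ℤ) : weight n ^ 2 = 1 + ‖(2 * Real.pi) • freq n‖ ^ 2 :=
  Real.sq_sqrt (by positivity)

theorem norm_le_weight (n : Fin 2 → ℤ) : ‖n‖ ≤ weight n := by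
  have h : ‖freq n‖ ≤ weight n := by
    refine abs_le_of_sq_le_sq' ?_ (weight_pos n).le |>.2
    rw [weight_sq, norm_smul, mul_pow, Real.norm_of_nonneg Real.two_pi_pos.le]
    nlinarith [Real.pi_gt_three, sq_nonneg ‖freq n‖,
      mul_nonneg (sq_nonneg ‖freq n‖) (by nlinarith [Real.pi_gt_three] : 0 ≤ (2 * Real.pi) ^ 2 - 1)]
  refine le_trans ((pi_norm_le_iff_of_nonneg (norm_nonneg _)).2 fun i => ?_) h
  exact PiLp.norm_apply_le (freq n) i

theorem summable_weight_rpow {q : ℝ} (hq : 2 < q) : Summable fun n => weight n ^ (-q) := by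
  -- The comparison series uses the sup norm on `ℤ²`; the frequency `0`, where the comparison may
  -- fail, is discarded.
  refine (EisensteinSeries.summable_one_div_norm_rpow hq).of_norm_bounded_eventually ?_
  filter_upwards [(Set.finite_singleton (0 : Fin 2 → ℤ)).compl_mem_cofinite] with n hn
  rw [Real.norm_of_nonneg (weight_rpow_pos n _).le]
  exact Real.rpow_le_rpow_of_nonpos (norm_pos_iff.2 hn) (norm_le_weight n) (by linarith)

/-- Convexity of the power, from Bernoulli's inequality at `y / x`. -/
theorem rpow_sub_rpow_le {x y s : ℝ} (hy : 0 ≤ y) (hx : 0 < x) (hs : 1 ≤ s) :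
    x ^ s - y ^ s ≤ s * x ^ (s - 1) * (x - y) := by
  have h := one_add_mul_self_le_rpow_one_add (s := y / x - 1) (by
    have := div_nonneg hy hx.le; linarith) hs
  rw [add_sub_cancel, Real.div_rpow hy hx.le, le_div_iff₀ (Real.rpow_pos_of_pos hx s)] at h
  have e : x ^ s = x ^ (s - 1) * x := by
    rw [Real.rpow_sub_one hx.ne', div_mul_cancel₀ _ hx.ne']
  have e2 : (1 + s * (y / x - 1)) * x ^ s = x ^ s + s * x ^ (s - 1) * (y - x) := by
    rw [e]; field_simp
  linarith

/-- The difference `Z^s - X^s` costs `X^{s-1} Y` up to a constant, since `Z ≤ 2X`. As `Y ≤ X` and `r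
≥ s - 1`, the surplus `r - (s - 1)` of powers of `Y` may be traded for powers of `X`; likewise `Y^s
≤ X^r Y^{s-r}`. -/
theorem abs_rpow_sub_rpow_sub_rpow_le {X Y Z s r : ℝ} (hY : 1 ≤ Y) (hZ : 0 ≤ Z) (hYX : Y ≤ X)
    (hZX : |Z - X| ≤ Y) (hs : 1 ≤ s) (hr : s - 1 ≤ r) (hr' : 0 ≤ r) :
    |Z ^ s - X ^ s - Y ^ s| ≤ (s * 2 ^ (s - 1) + 1) * (X ^ r * Y ^ (s - r)) := by
  have hX : 0 < X := by linarith
  have hY0 : 0 < Y := by linarith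
  obtain ⟨h1, h2⟩ := abs_sub_le_iff.1 hZX
  have hXY : X ^ (s - 1) * Y ≤ X ^ r * Y ^ (s - r) := by
    have e1 : X ^ r = X ^ (s - 1) * X ^ (r - (s - 1)) := by
      rw [← Real.rpow_add hX]; ring_nf
    have e2 : Y = Y ^ (r - (s - 1)) * Y ^ (s - r) := by
      rw [← Real.rpow_add hY0]; ring_nf; rw [Real.rpow_one]
    rw [e1, mul_assoc]
    refine mul_le_mul_of_nonneg_left ?_ (Real.rpow_nonneg hX.le _)
    refine e2.trans_le (mul_le_mul_of_nonneg_right ?_ (Real.rpow_nonneg hY0.le _))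
    exact Real.rpow_le_rpow hY0.le hYX (by linarith)
  have hYs : Y ^ s ≤ X ^ r * Y ^ (s - r) := by
    have e : Y ^ s = Y ^ r * Y ^ (s - r) := by rw [← Real.rpow_add hY0]; ring_nf
    rw [e]
    exact mul_le_mul_of_nonneg_right (Real.rpow_le_rpow hY0.le hYX hr')
      (Real.rpow_nonneg hY0.le _)
  have key (M : ℝ) (hM0 : 0 ≤ M) (hM : M ≤ 2 * X) :
      s * M ^ (s - 1) * Y ≤ s * 2 ^ (s - 1) * (X ^ r * Y ^ (s - r)) := by
    have h3 : M ^ (s - 1) ≤ 2 ^ (s - 1) * X ^ (s - 1) := by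
      rw [← Real.mul_rpow zero_le_two hX.le]
      exact Real.rpow_le_rpow hM0 hM (by linarith)
    calc s * M ^ (s - 1) * Y ≤ s * (2 ^ (s - 1) * X ^ (s - 1)) * Y := by gcongr
      _ = s * 2 ^ (s - 1) * (X ^ (s - 1) * Y) := by ring
      _ ≤ _ := by gcongr
  have hup : |Z ^ s - X ^ s| ≤ s * 2 ^ (s - 1) * (X ^ r * Y ^ (s - r)) := by
    rw [abs_sub_le_iff]
    constructor
    · rcases hZ.eq_or_lt with h0 | h0
      · have : 0 ≤ s * 2 ^ (s - 1) * (X ^ r * Y ^ (s - r)) := by positivity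
        rw [← h0, Real.zero_rpow (by linarith)]
        have := Real.rpow_nonneg hX.le s
        linarith
      · refine (rpow_sub_rpow_le hX.le h0 hs).trans (le_trans ?_ (key Z hZ (by linarith)))
        gcongr
    · refine (rpow_sub_rpow_le hZ hX hs).trans (le_trans ?_ (key X hX.le (by linarith)))
      gcongr
  calc |Z ^ s - X ^ s - Y ^ s| ≤ |Z ^ s - X ^ s| + |Y ^ s| := abs_sub _ _
    _ ≤ s * 2 ^ (s - 1) * (X ^ r * Y ^ (s - r)) + X ^ r * Y ^ (s - r) := by
      rw [abs_of_nonneg (Real.rpow_nonneg hY0.le s)]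
      exact add_le_add hup hYs
    _ = _ := by ring

theorem abs_weight_add_rpow_sub_le (m n : Fin 2 → ℤ) {s r : ℝ} (hs : 1 ≤ s) (hr : s - 1 ≤ r) :
    |weight (m + n) ^ s - weight m ^ s - weight n ^ s| ≤ (s * 2 ^ (s - 1) + 1) *
      (weight m ^ r * weight n ^ (s - r) + weight m ^ (s - r) * weight n ^ r) := by
  have hp (k : Fin 2 → ℤ) (q : ℝ) := (weight_rpow_pos k q).le
  have hC : 0 ≤ s * 2 ^ (s - 1) + 1 := by positivity
  rcases le_total (weight n) (weight m) with h | h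
  · refine (abs_rpow_sub_rpow_sub_rpow_le (one_le_weight n) (weight_pos _).le h
      (abs_weight_add_sub_le m n) hs hr (by linarith)).trans ?_
    gcongr
    exact le_add_of_nonneg_right (mul_nonneg (hp _ _) (hp _ _))
  · rw [sub_right_comm, add_comm m n]
    refine (abs_rpow_sub_rpow_sub_rpow_le (one_le_weight m) (weight_pos _).le h
      (abs_weight_add_sub_le n m) hs hr (by linarith)).trans ?_
    gcongr
    rw [mul_comm (weight m ^ (s - r))]
    exact le_add_of_nonneg_left (mul_nonneg (hp _ _) (hp _ _))

/-! ### Bernstein's inequality for trigonometric polynomials. -/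

theorem integral_fourier (m : ℤ) :
    ∫ θ : UnitAddCircle, fourier m θ ∂AddCircle.haarAddCircle = if m = 0 then 1 else 0 := by
  have h := orthonormal_iff_ite.1 (orthonormal_fourier (T := 1)) 0 m
  rw [ContinuousMap.inner_toLp] at h
  simpa [eq_comm] using h

/-- The Dirichlet-type sum `∑_{a<M} e_a` on the circle. -/
noncomputable def dirichletSum (M : ℕ) : C(UnitAddCircle, ℂ) :=
  ∑ a ∈ Finset.range M, fourier (a : ℤ)

/-- A kernel on the circle whose `k`-th Fourier coefficient is `k` for `|k| ≤ M`. -/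
noncomputable def bernsteinKernel (M : ℕ) : C(UnitAddCircle, ℂ) :=
  (fourier (M : ℤ) - fourier (-(M : ℤ))) * (dirichletSum M * star (dirichletSum M))

theorem dirichletSum_mul_star_apply (M : ℕ) (θ : UnitAddCircle) :
    dirichletSum M θ * star (dirichletSum M θ) =
      ∑ a ∈ Finset.range M, ∑ b ∈ Finset.range M, fourier ((a : ℤ) - b) θ := by
  simp only [dirichletSum, ContinuousMap.coe_sum, Finset.sum_apply, star_sum, Finset.sum_mul_sum]
  refine Finset.sum_congr rfl fun a _ => Finset.sum_congr rfl fun b _ => ?_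
  rw [sub_eq_add_neg, fourier_add, fourier_neg]
  rfl

theorem ContinuousMap.integrable_haarAddCircle (f : C(UnitAddCircle, ℂ)) :
    Integrable f AddCircle.haarAddCircle :=
  f.continuous.integrable_of_hasCompactSupport (HasCompactSupport.of_compactSpace f)

/-- Only `a = b - m` survives in the double sum, so this is the Fejér coefficient `(M - |m|)₊`,
written as a cardinality. -/
theorem integral_fourier_mul_dirichletSum (M : ℕ) (m : ℤ) :
    ∫ θ : UnitAddCircle, fourier m θ * (dirichletSum M θ * star (dirichletSum M θ))
      ∂AddCircle.haarAddCircle =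
      ((Finset.range M).filter fun b : ℕ => 0 ≤ (b : ℤ) - m ∧ (b : ℤ) - m < M).card := by
  simp only [dirichletSum_mul_star_apply, Finset.mul_sum, ← fourier_add]
  rw [integral_finsetSum _ fun a _ => integrable_finsetSum _ fun b _ =>
    (fourier _).integrable_haarAddCircle]
  simp only [integral_finsetSum _ fun b _ => (fourier _).integrable_haarAddCircle]
  simp only [integral_fourier]
  rw [Finset.sum_comm, Finset.card_filter]
  push_cast
  refine Finset.sum_congr rfl fun b _ => ?_
  split_ifs with h
  · obtain ⟨c, hc⟩ := Int.eq_ofNat_of_zero_le h.1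
    rw [Finset.sum_eq_single c]
    · rw [if_pos (by omega)]
    · intro d _ hd
      rw [if_neg (by omega)]
    · intro hcM
      rw [Finset.mem_range] at hcM
      omega
  · refine Finset.sum_eq_zero fun a ha => if_neg ?_
    rw [Finset.mem_range] at ha
    omega

/-- The difference of two shifted triangles, `(M - |k + M|)₊ - (M - |k - M|)₊`, is linear in `k` on
`[-M, M]`. -/
theorem integral_fourier_mul_bernsteinKernel (M : ℕ) {k : ℤ} (hk : |k| ≤ M) :
    ∫ θ : UnitAddCircle, fourier k θ * bernsteinKernel M θ ∂AddCircle.haarAddCircle = -k := by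
  have e (θ : UnitAddCircle) : fourier k θ * bernsteinKernel M θ =
      fourier (k + M) θ * (dirichletSum M θ * star (dirichletSum M θ)) -
        fourier (k - M) θ * (dirichletSum M θ * star (dirichletSum M θ)) := by
    change fourier k θ * ((fourier (M : ℤ) θ - fourier (-(M : ℤ)) θ) *
      (dirichletSum M θ * star (dirichletSum M θ))) = _
    rw [sub_eq_add_neg k, fourier_add, fourier_add]
    ring
  simp only [e]
  rw [integral_sub
    (fourier (k + M) * (dirichletSum M * star (dirichletSum M))).integrable_haarAddCircle
    (fourier (k - M) * (dirichletSum M * star (dirichletSum M))).integrable_haarAddCircle,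
    integral_fourier_mul_dirichletSum, integral_fourier_mul_dirichletSum]
  obtain ⟨h1, h2⟩ := abs_le.1 hk
  rcases le_total 0 k with h | h
  · obtain ⟨c, rfl⟩ := Int.eq_ofNat_of_zero_le h
    rw [Finset.filter_false_of_mem, Finset.card_empty]
    · have : (Finset.range M).filter (fun b : ℕ => 0 ≤ (b : ℤ) - (c - M) ∧ (b : ℤ) - (c - M) < M)
          = Finset.range c := by
        ext b; simp only [Finset.mem_filter, Finset.mem_range]; omega
      rw [this]; simp
    · intro b hb; rw [Finset.mem_range] at hb; omega
  · obtain ⟨c, hc⟩ := Int.eq_ofNat_of_zero_le (neg_nonneg.2 h)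
    obtain rfl : k = -(c : ℤ) := by omega
    rw [Finset.filter_false_of_mem (p := fun b : ℕ => 0 ≤ (b : ℤ) - (-c - M) ∧ _),
      Finset.card_empty]
    · have : (Finset.range M).filter (fun b : ℕ => 0 ≤ (b : ℤ) - (-c + M) ∧ (b : ℤ) - (-c + M) < M)
          = (Finset.range M) \ Finset.range (M - c) := by
        ext b; simp only [Finset.mem_filter, Finset.mem_range, Finset.mem_sdiff]; omega
      rw [this, Finset.card_sdiff_of_subset (Finset.range_mono (by omega))]
      simp only [Finset.card_range]
      rw [Nat.sub_sub_self (by omega)]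
      simp
    · intro b hb; rw [Finset.mem_range] at hb; omega

/-- The factor `e_M - e_{-M}` is at most 2, and the Fejér factor is nonnegative with integral `M`.
-/
theorem integral_norm_bernsteinKernel_le (M : ℕ) :
    ∫ θ : UnitAddCircle, ‖bernsteinKernel M θ‖ ∂AddCircle.haarAddCircle ≤ 2 * M := by
  have h := integral_fourier_mul_dirichletSum M 0
  have e (θ : UnitAddCircle) : fourier 0 θ * (dirichletSum M θ * star (dirichletSum M θ)) =
      ((‖dirichletSum M θ‖ ^ 2 : ℝ) : ℂ) := by
    rw [fourier_zero, one_mul, RCLike.star_def, Complex.mul_conj']; push_cast; rfl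
  simp only [e, integral_complex_ofReal] at h
  rw [Finset.filter_true_of_mem (by simp), Finset.card_range] at h
  replace h : ∫ θ : UnitAddCircle, ‖dirichletSum M θ‖ ^ 2 ∂AddCircle.haarAddCircle = M := by
    exact_mod_cast h
  rw [← h, ← integral_const_mul]
  refine integral_mono (bernsteinKernel M).integrable_haarAddCircle.norm ?_ fun θ => ?_
  · exact Continuous.integrable_of_hasCompactSupport (by fun_prop)
      (HasCompactSupport.of_compactSpace _)
  · change ‖(fourier (M : ℤ) θ - fourier (-(M : ℤ)) θ) *
      (dirichletSum M θ * star (dirichletSum M θ))‖ ≤ 2 * ‖dirichletSum M θ‖ ^ 2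
    rw [norm_mul, norm_mul, norm_star, sq]
    gcongr
    refine (norm_sub_le _ _).trans ?_
    simp only [fourier_apply, Circle.norm_coe]
    norm_num

/-- Trigonometric polynomials on `𝕋²` of degree at most `M` in each variable. -/
noncomputable def trigPoly (M : ℕ) : Submodule ℂ C(Torus2, ℂ) :=
  Submodule.span ℂ (mFourier '' {n | ∀ i, |n i| ≤ M})

theorem mFourier_mem_trigPoly {M : ℕ} {n : Fin 2 → ℤ} (hn : ∀ i, |n i| ≤ M) :
    mFourier n ∈ trigPoly M := Submodule.subset_span ⟨n, hn, rfl⟩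

theorem trigPoly_mono {M N : ℕ} (h : M ≤ N) : trigPoly M ≤ trigPoly N :=
  Submodule.span_mono (Set.image_mono fun n hn i => (hn i).trans (by exact_mod_cast h))

theorem mul_mem_trigPoly {M N : ℕ} {f g : C(Torus2, ℂ)} (hf : f ∈ trigPoly M)
    (hg : g ∈ trigPoly N) : f * g ∈ trigPoly (M + N) := by
  have h := Submodule.mul_mem_mul hf hg
  rw [trigPoly, trigPoly, Submodule.span_mul_span] at h
  refine Submodule.span_mono ?_ h
  rintro _ ⟨_, ⟨m, hm, rfl⟩, _, ⟨n, hn, rfl⟩, rfl⟩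
  refine ⟨m + n, fun i => ?_, ?_⟩
  · push_cast
    exact (abs_add_le _ _).trans (add_le_add (hm i) (hn i))
  · ext x; simp [mFourier_add]

theorem mFourierCoeff_eq_zero_of_mem_trigPoly {M : ℕ} {f : C(Torus2, ℂ)} (hf : f ∈ trigPoly M)
    {n : Fin 2 → ℤ} {i : Fin 2} (hn : (M : ℤ) < |n i|) : mFourierCoeff f n = 0 := by
  have h : trigPoly M ≤ LinearMap.ker (mFourierCoeffCLM n).toLinearMap := by
    rw [trigPoly, Submodule.span_le]
    rintro _ ⟨m, hm, rfl⟩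
    have hmn : m ≠ n := by
      rintro rfl
      exact (hm i).not_gt hn
    simp [mFourierCoeff_mFourier, hmn]
  exact h hf

theorem mFourier_add_single (n : Fin 2 → ℤ) (x : Torus2) (i : Fin 2) (θ : UnitAddCircle) :
    mFourier n (x + Pi.single i θ) = mFourier n x * fourier (n i) θ := by
  fin_cases i <;> simp [mFourier, Fin.prod_univ_two, fourier_apply, smul_add, AddCircle.toCircle_add] <;> ring

theorem continuous_add_single (x : Torus2) (i : Fin 2) :
    Continuous fun θ : UnitAddCircle => x + Pi.single i θ :=
  continuous_const.add (continuous_single (A := fun _ => UnitAddCircle) i)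

/-- Both sides are linear in `f`, so it suffices to test characters, on which convolution with the
kernel reproduces the frequency. -/
theorem hasDerivAt_of_mem_trigPoly {M : ℕ} {f : C(Torus2, ℂ)} (hf : f ∈ trigPoly M) (x : Torus2)
    (i : Fin 2) (r : ℝ) :
    HasDerivAt (fun r : ℝ => f (x + Pi.single i (r : UnitAddCircle)))
      (-(2 * Real.pi * Complex.I) * ∫ θ, f (x + Pi.single i (r : UnitAddCircle) + Pi.single i θ) *
        bernsteinKernel M θ ∂AddCircle.haarAddCircle) r := by
  have hint (f : C(Torus2, ℂ)) (x : Torus2) : Integrable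
      (fun θ => f (x + Pi.single i θ) * bernsteinKernel M θ) AddCircle.haarAddCircle :=
    (ContinuousMap.mk _ ((f.continuous.comp (continuous_add_single x i)).mul
      (bernsteinKernel M).continuous)).integrable_haarAddCircle
  induction hf using Submodule.span_induction with
  | mem f hf =>
    obtain ⟨n, hn, rfl⟩ := hf
    simp only [mFourier_add_single, mul_assoc (mFourier n x * _)]
    rw [integral_const_mul, integral_fourier_mul_bernsteinKernel M (hn i)]
    have h := (hasDerivAt_fourier 1 (n i) r).const_mul (mFourier n x)
    convert! h using 1
    push_cast
    ring
  | zero => simpa using hasDerivAt_const r (0 : ℂ)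
  | add f g _ _ hf hg =>
    convert! hf.add hg using 1
    rw [← mul_add, ← integral_add (hint f _) (hint g _)]
    simp [add_mul]
  | smul c f _ hf =>
    convert! hf.const_mul c using 1
    simp only [ContinuousMap.smul_apply, smul_eq_mul, mul_assoc c, integral_const_mul]
    ring

/-- Bernstein's inequality. -/
theorem norm_add_single_sub_le {M : ℕ} {f : C(Torus2, ℂ)} (hf : f ∈ trigPoly M) (x : Torus2)
    (i : Fin 2) (r : ℝ) :
    ‖f (x + Pi.single i (r : UnitAddCircle)) - f x‖ ≤ 4 * Real.pi * M * ‖f‖ * |r| := by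
  have h (t : ℝ) : ‖-(2 * Real.pi * Complex.I) * ∫ θ, f (x + Pi.single i (t : UnitAddCircle) +
      Pi.single i θ) * bernsteinKernel M θ ∂AddCircle.haarAddCircle‖ ≤ 4 * Real.pi * M * ‖f‖ := by
    have h1 : ‖∫ θ, f (x + Pi.single i (t : UnitAddCircle) +
        Pi.single i θ) * bernsteinKernel M θ ∂AddCircle.haarAddCircle‖ ≤ ‖f‖ * (2 * M) := by
      refine (norm_integral_le_of_norm_le
        ((bernsteinKernel M).integrable_haarAddCircle.norm.const_mul ‖f‖)
        (.of_forall fun θ => ?_)).trans ?_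
      · rw [norm_mul]
        gcongr
        exact f.norm_coe_le_norm _
      · rw [integral_const_mul]
        gcongr
        exact integral_norm_bernsteinKernel_le M
    rw [norm_mul, norm_neg, norm_mul, norm_mul, Complex.norm_I, Complex.norm_real,
      Real.norm_of_nonneg Real.pi_pos.le, RCLike.norm_ofNat]
    nlinarith [Real.pi_pos]
  have := Convex.norm_image_sub_le_of_norm_hasDerivWithin_le (s := Set.univ) (x := 0) (y := r)
    (fun t _ => (hasDerivAt_of_mem_trigPoly hf x i t).hasDerivWithinAt) (fun t _ => h t)
    convex_univ trivial trivial
  simpa using this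

/-- The projection `ℝ² → 𝕋²`. -/
noncomputable def torusMk (y : EuclideanSpace ℝ (Fin 2)) : Torus2 :=
  fun i => (y i : UnitAddCircle)

theorem continuous_torusMk : Continuous torusMk :=
  continuous_pi fun i => (AddCircle.continuous_mk' 1).comp (PiLp.continuous_apply 2 _ i)

theorem norm_add_torusMk_sub_le {M : ℕ} {f : C(Torus2, ℂ)} (hf : f ∈ trigPoly M) (x : Torus2)
    (y : EuclideanSpace ℝ (Fin 2)) :
    ‖f (x + torusMk y) - f x‖ ≤ 8 * Real.pi * M * ‖f‖ * ‖y‖ := by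
  have e : x + torusMk y = x + Pi.single 0 (y 0 : UnitAddCircle) +
      Pi.single 1 (y 1 : UnitAddCircle) := by
    ext i; fin_cases i <;> simp [torusMk]
  have h0 : |y 0| ≤ ‖y‖ := PiLp.norm_apply_le y 0
  have h1 : |y 1| ≤ ‖y‖ := PiLp.norm_apply_le y 1
  have hC : 0 ≤ 4 * Real.pi * M * ‖f‖ := by positivity
  rw [e]
  refine (norm_sub_le_norm_sub_add_norm_sub _ (f (x + Pi.single 0 (y 0 : UnitAddCircle))) _).trans ?_
  refine (add_le_add (norm_add_single_sub_le hf _ _ _) (norm_add_single_sub_le hf _ _ _)).trans ?_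
  nlinarith

/-! ### Dyadic sums: Sobolev bounds, Hölder bounds and squares. -/

/-- `f = ∑ⱼ Vⱼ` with trigonometric polynomials `Vⱼ` of degree at most `D 2ʲ` and
`‖Vⱼ‖_∞ ≤ K 2^{-jα}`. -/
structure DyadicSum (D : ℕ) (α K : ℝ) (f : C(Torus2, ℂ)) (V : ℕ → C(Torus2, ℂ)) : Prop where
  mem : ∀ j, V j ∈ trigPoly (D * 2 ^ j)
  norm_le : ∀ j, ‖V j‖ ≤ K * ((2 : ℝ) ^ (-α)) ^ j
  hasSum : HasSum V f

theorem hasSum_mul_two_rpow_geometric (C : ℝ) {α : ℝ} (hα : 0 < α) :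
    HasSum (fun j : ℕ => C * ((2 : ℝ) ^ (-α)) ^ j) (C * (1 - 2 ^ (-α))⁻¹) :=
  (hasSum_geometric_of_lt_one (Real.rpow_nonneg zero_le_two _)
    (Real.rpow_lt_one_of_one_lt_of_neg one_lt_two (by linarith))).mul_left C

theorem two_rpow_neg_sub_pow (α β : ℝ) (j : ℕ) :
    ((2 : ℝ) ^ (-(α - β))) ^ j = ((2 : ℝ) ^ (-α)) ^ j * ((2 : ℝ) ^ j) ^ β := by
  rw [← Real.rpow_natCast 2 j, ← Real.rpow_mul zero_le_two,
    ← Real.rpow_mul_natCast zero_le_two, ← Real.rpow_mul_natCast zero_le_two,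
    ← Real.rpow_add zero_lt_two]
  ring_nf

theorem one_sub_two_rpow_pos {α : ℝ} (hα : 0 < α) : 0 < 1 - (2 : ℝ) ^ (-α) :=
  sub_pos.2 (Real.rpow_lt_one_of_one_lt_of_neg one_lt_two (by linarith))

theorem weight_le_of_abs_le {D : ℕ} (hD : 1 ≤ D) {j : ℕ} {n : Fin 2 → ℤ}
    (hn : ∀ i, |n i| ≤ (D * 2 ^ j : ℕ)) : weight n ≤ 10 * D * 2 ^ j := by
  refine abs_le_of_sq_le_sq' ?_ (by positivity) |>.2
  have h (i : Fin 2) : (n i : ℝ) ^ 2 ≤ (D * 2 ^ j : ℝ) ^ 2 := by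
    rw [sq_le_sq, abs_of_nonneg (by positivity : (0 : ℝ) ≤ D * 2 ^ j)]
    have := hn i
    exact_mod_cast this
  have hD' : (1 : ℝ) ≤ (D * 2 ^ j : ℝ) ^ 2 := by
    apply one_le_pow₀
    have : (1 : ℝ) ≤ D := by exact_mod_cast hD
    have := one_le_pow₀ one_le_two (M₀ := ℝ) (n := j)
    nlinarith
  rw [weight_sq, norm_smul, mul_pow, Real.norm_of_nonneg Real.two_pi_pos.le,
    EuclideanSpace.norm_sq_eq, Fin.sum_univ_two]
  have e (i : Fin 2) : ‖(freq n) i‖ ^ 2 = (n i : ℝ) ^ 2 := by simp [freq]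
  rw [e, e]
  -- With `R = D 2^j ≥ 1`, the squared weight is at most `1 + 40 · 2R² ≤ 81R²`, which explains the
  -- factor 10.
  have hpi : (2 * Real.pi) ^ 2 ≤ 40 := by nlinarith [Real.pi_pos, Real.pi_lt_d2]
  nlinarith [h 0, h 1, sq_nonneg (n 0 : ℝ), sq_nonneg (n 1 : ℝ)]

namespace DyadicSum

variable {D : ℕ} {α K : ℝ} {f : C(Torus2, ℂ)} {V : ℕ → C(Torus2, ℂ)}

theorem nonneg (h : DyadicSum D α K f V) : 0 ≤ K := by
  simpa using (norm_nonneg _).trans (h.norm_le 0)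

theorem norm_le_mul (h : DyadicSum D α K f V) (hα : 0 < α) : ‖f‖ ≤ K * (1 - 2 ^ (-α))⁻¹ := by
  rw [← h.hasSum.tsum_eq]
  exact tsum_of_norm_bounded (hasSum_mul_two_rpow_geometric K hα) h.norm_le

/-- By Parseval the coefficients of `Vⱼ` have `ℓ²` norm at most `‖Vⱼ‖_∞`. On their support the
weight is at most `10 D 2^j`, so block `j` contributes `O(2^{-j(α-r)})`, a convergent geometric
series. -/
theorem sqSumLE (h : DyadicSum D α K f V) (hD : 1 ≤ D) {r : ℝ} (hr : 0 ≤ r) (hrα : r < α) :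
    SqSumLE (fun n => weight n ^ r * ‖mFourierCoeff f n‖)
      ((10 * D) ^ r * (1 - 2 ^ (-(α - r)))⁻¹ * K) := by
  set X : ℕ → (Fin 2 → ℤ) → ℝ := fun j n => weight n ^ r * ‖mFourierCoeff (V j) n‖ with hX
  set c : ℕ → ℝ := fun j => (10 * D) ^ r * K * ((2 : ℝ) ^ (-(α - r))) ^ j with hc
  have hXc (j : ℕ) : SqSumLE (X j) (c j) := by
    have h1 : SqSumLE (fun n => ‖mFourierCoeff (V j) n‖) ‖V j‖ := by
      refine SqSumLE.of_hasSum (hasSum_sq_norm_mFourierCoeff (V j)) (norm_nonneg _) ?_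
      refine (integral_mono_of_nonneg (.of_forall fun t => by positivity)
        (integrable_const (‖V j‖ ^ 2)) (.of_forall fun t => ?_)).trans (by simp)
      exact pow_le_pow_left₀ (norm_nonneg _) ((V j).norm_coe_le_norm t) 2
    have h2 := h1.const_mul (c := ((10 * D : ℝ) * 2 ^ j) ^ r) (by positivity)
    refine (h2.mono fun n => ?_).mono_right ?_
    · rw [abs_of_nonneg (mul_nonneg (weight_rpow_pos n r).le (norm_nonneg _))]
      by_cases hn : ∀ i, |n i| ≤ (D * 2 ^ j : ℕ)
      · exact mul_le_mul_of_nonneg_right (Real.rpow_le_rpow (weight_pos n).le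
          (weight_le_of_abs_le hD hn) hr) (norm_nonneg _)
      · push Not at hn
        obtain ⟨i, hi⟩ := hn
        simp [mFourierCoeff_eq_zero_of_mem_trigPoly (h.mem j) hi]
    · refine (mul_le_mul_of_nonneg_left (h.norm_le j) (by positivity)).trans_eq ?_
      rw [Real.mul_rpow (by positivity) (by positivity)]
      simp only [hc, two_rpow_neg_sub_pow]
      ring
  have hcs := hasSum_mul_two_rpow_geometric ((10 * D) ^ r * K) (sub_pos.2 hrα)
  have hXs (n : Fin 2 → ℤ) : Summable fun j => X j n :=
    hcs.summable.of_norm_bounded fun j => (hXc j).le n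
  have hmain := SqSumLE.hasSum hXc hcs fun n => (hXs n).hasSum
  rw [mul_right_comm] at hmain
  refine hmain.mono fun n => ?_
  rw [abs_of_nonneg (mul_nonneg (weight_rpow_pos n r).le (norm_nonneg _))]
  have hs : HasSum (fun j => ((weight n ^ r : ℝ) : ℂ) * mFourierCoeff (V j) n)
      (((weight n ^ r : ℝ) : ℂ) * mFourierCoeff f n) :=
    ((mFourierCoeffCLM n).hasSum h.hasSum).mul_left _
  have e (z : ℂ) : weight n ^ r * ‖z‖ = ‖((weight n ^ r : ℝ) : ℂ) * z‖ := by
    rw [norm_mul, Complex.norm_real, Real.norm_of_nonneg (weight_rpow_pos n r).le]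
  rw [e, ← hs.tsum_eq]
  refine tsum_of_norm_bounded (hXs n).hasSum fun j => ?_
  rw [← e]

/-- Interpolation in each block between the trivial bound `2‖Vⱼ‖` and Bernstein's bound `2‖Vⱼ‖ z`,
through `min(1, z) ≤ z^β`; the blocks then sum geometrically because `β < α`. -/
theorem holder (h : DyadicSum D α K f V) {β : ℝ} (hβ : 0 ≤ β) (hβ1 : β ≤ 1) (hβα : β < α)
    (x : Torus2) (y : EuclideanSpace ℝ (Fin 2)) :
    ‖f (x + torusMk y) - f x‖ ≤
      2 * (4 * Real.pi * D) ^ β * (1 - 2 ^ (-(α - β)))⁻¹ * K * ‖y‖ ^ β := by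
  have hs : HasSum (fun j => V j (x + torusMk y) - V j x) (f (x + torusMk y) - f x) :=
    ((ContinuousMap.evalCLM ℂ (x + torusMk y)).hasSum h.hasSum).sub
      ((ContinuousMap.evalCLM ℂ x).hasSum h.hasSum)
  have hc := hasSum_mul_two_rpow_geometric (2 * (4 * Real.pi * D) ^ β * K * ‖y‖ ^ β)
    (sub_pos.2 hβα)
  have hb (j : ℕ) : ‖V j (x + torusMk y) - V j x‖ ≤
      2 * (4 * Real.pi * D) ^ β * K * ‖y‖ ^ β * ((2 : ℝ) ^ (-(α - β))) ^ j := by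
    set z : ℝ := 4 * Real.pi * D * 2 ^ j * ‖y‖ with hz
    have hz0 : 0 ≤ z := by positivity
    have h1 : ‖V j (x + torusMk y) - V j x‖ ≤ 2 * ‖V j‖ * 1 := by
      refine (norm_sub_le _ _).trans ?_
      linarith [(V j).norm_coe_le_norm (x + torusMk y), (V j).norm_coe_le_norm x]
    have h2 : ‖V j (x + torusMk y) - V j x‖ ≤ 2 * ‖V j‖ * z := by
      refine (norm_add_torusMk_sub_le (h.mem j) x y).trans_eq ?_
      rw [hz]; push_cast; ring
    have h3 : ‖V j (x + torusMk y) - V j x‖ ≤ 2 * ‖V j‖ * z ^ β := by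
      rcases le_total z 1 with hz1 | hz1
      · refine h2.trans (mul_le_mul_of_nonneg_left ?_ (by positivity))
        rcases hz0.eq_or_lt with h0 | h0
        · rw [← h0]; exact Real.rpow_nonneg le_rfl _
        · simpa using Real.rpow_le_rpow_of_exponent_ge h0 hz1 hβ1
      · exact h1.trans (mul_le_mul_of_nonneg_left (Real.one_le_rpow hz1 hβ) (by positivity))
    have hK := h.norm_le j
    refine h3.trans ((mul_le_mul_of_nonneg_right (mul_le_mul_of_nonneg_left hK zero_le_two)
      (Real.rpow_nonneg hz0 _)).trans_eq ?_)
    rw [hz, Real.mul_rpow (by positivity) (by positivity),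
      Real.mul_rpow (by positivity) (by positivity)]
    rw [two_rpow_neg_sub_pow]
    ring
  rw [← hs.tsum_eq]
  refine (tsum_of_norm_bounded hc hb).trans_eq ?_
  ring

/-- With partial sums `S_J`, the blocks of the square are `S_{J+1}² - S_J² = V_J (S_{J+1} + S_J)`.
One factor keeps the decay, the other is bounded uniformly, and the degrees at most double. -/
theorem exists_sq (h : DyadicSum D α K f V) (hα : 0 < α) :
    ∃ W, DyadicSum (2 * D) α (2 * (1 - 2 ^ (-α))⁻¹ * K ^ 2) (f ^ 2) W := by
  set S : ℕ → C(Torus2, ℂ) := fun J => ∑ j ∈ Finset.range J, V j with hS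
  have hq := one_sub_two_rpow_pos hα
  have hSmem (J : ℕ) : S (J + 1) ∈ trigPoly (D * 2 ^ J) :=
    Submodule.sum_mem _ fun j hj => trigPoly_mono (by
      gcongr
      · norm_num
      · exact Nat.lt_succ_iff.1 (Finset.mem_range.1 hj)) (h.mem j)
  have hSmem' (J : ℕ) : S J ∈ trigPoly (D * 2 ^ J) := by
    cases J with
    | zero => simp [hS]
    | succ J => exact trigPoly_mono (by gcongr <;> simp) (hSmem J)
  have hgeom := hasSum_mul_two_rpow_geometric K hα
  have hSnorm (J : ℕ) : ‖S J‖ ≤ K * (1 - 2 ^ (-α))⁻¹ :=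
    (norm_sum_le_of_le _ fun j _ => h.norm_le j).trans
      (sum_le_hasSum _ (fun j _ => (norm_nonneg _).trans (h.norm_le j)) hgeom)
  have hW (J : ℕ) : S (J + 1) ^ 2 - S J ^ 2 = V J * (S (J + 1) + S J) := by
    simp only [hS, Finset.sum_range_succ]; ring
  have hWnorm (J : ℕ) : ‖S (J + 1) ^ 2 - S J ^ 2‖ ≤
      2 * (1 - 2 ^ (-α))⁻¹ * K ^ 2 * ((2 : ℝ) ^ (-α)) ^ J := by
    rw [hW]
    refine (norm_mul_le _ _).trans ((mul_le_mul (h.norm_le J) ((norm_add_le _ _).trans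
      (add_le_add (hSnorm _) (hSnorm _))) (norm_nonneg _)
      ((norm_nonneg _).trans (h.norm_le J))).trans_eq ?_)
    ring
  refine ⟨fun J => S (J + 1) ^ 2 - S J ^ 2, fun J => ?_, hWnorm, ?_⟩
  · have := mul_mem_trigPoly (h.mem J) (Submodule.add_mem _ (hSmem J) (hSmem' J))
    rw [hW]
    convert! this using 2
    ring
  · have hsum : Summable fun J => S (J + 1) ^ 2 - S J ^ 2 :=
      (hasSum_mul_two_rpow_geometric _ hα).summable.of_norm_bounded hWnorm
    rw [hsum.hasSum_iff_tendsto_nat]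
    simp only [Finset.sum_range_sub fun J => S J ^ 2]
    have h0 : S 0 ^ 2 = 0 := by simp [hS]
    simp only [h0, sub_zero]
    exact h.hasSum.tendsto_sum_nat.pow 2

end DyadicSum

/-! ### Littlewood–Paley blocks and the continuous representative. -/

namespace IsLPBump

variable {φ : ℝ → ℝ}

theorem eq_zero (hφ : IsLPBump φ) {r : ℝ} (hr : 8 / 5 < r) : φ r = 0 := by
  by_contra h
  exact (hφ.support (subset_tsupport φ h)).2.not_gt hr

theorem lpBump_eq_zero_of_lt (hφ : IsLPBump φ) {j : ℕ} {ξ : EuclideanSpace ℝ (Fin 2)}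
    (h : 8 / 5 * 2 ^ j < ‖ξ‖) : lpBump φ j ξ = 0 := by
  cases j with
  | zero => exact hφ.eq_zero (by simpa using h)
  | succ j =>
    have h1 : 8 / 5 < ‖((2 : ℝ) ^ (j + 1))⁻¹ • ξ‖ := by
      rw [norm_smul, norm_inv, norm_pow, Real.norm_ofNat, inv_mul_eq_div, lt_div_iff₀ (by positivity)]
      exact h
    have h2 : 8 / 5 < ‖((2 : ℝ) ^ j)⁻¹ • ξ‖ := by
      rw [norm_smul, norm_inv, norm_pow, Real.norm_ofNat, inv_mul_eq_div, lt_div_iff₀ (by positivity)]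
      rw [pow_succ] at h
      nlinarith [pow_pos (zero_lt_two (α := ℝ)) j]
    rw [lpBump, hφ.eq_zero h1, hφ.eq_zero h2, sub_zero]

theorem sum_lpBump (φ : ℝ → ℝ) (J : ℕ) (ξ : EuclideanSpace ℝ (Fin 2)) :
    ∑ l ∈ Finset.range (J + 1), lpBump φ l ξ = φ ‖((2 : ℝ) ^ J)⁻¹ • ξ‖ := by
  induction J with
  | zero => simp [lpBump]
  | succ J ih => rw [Finset.sum_range_succ, ih, lpBump]; ring

/-- The partial sums telescope to `φ (2^{-J} |ξ|)`, which equals 1 for large `J`. Hence the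
normalising denominator in the symbol of the projector is 1. -/
theorem hasSum_lpBump (hφ : IsLPBump φ) (ξ : EuclideanSpace ℝ (Fin 2)) :
    HasSum (fun l => lpBump φ l ξ) 1 := by
  obtain ⟨J, hJ⟩ := pow_unbounded_of_one_lt ‖ξ‖ one_lt_two
  have h1 (m : ℕ) (hm : J ≤ m) : φ ‖((2 : ℝ) ^ m)⁻¹ • ξ‖ = 1 := by
    refine hφ.eq_one _ ⟨by linarith [norm_nonneg (((2 : ℝ) ^ m)⁻¹ • ξ)], ?_⟩
    rw [norm_smul, norm_inv, norm_pow, Real.norm_ofNat, inv_mul_eq_div, div_le_iff₀ (by positivity)]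
    have : (2 : ℝ) ^ J ≤ 2 ^ m := pow_le_pow_right₀ one_le_two hm
    linarith [pow_pos (zero_lt_two (α := ℝ)) m]
  rw [← h1 J le_rfl, ← sum_lpBump φ]
  refine hasSum_sum_of_ne_finset_zero fun l hl => ?_
  rw [Finset.mem_range, not_lt] at hl
  obtain ⟨m, rfl⟩ : ∃ m, l = m + 1 := ⟨l - 1, by omega⟩
  rw [lpBump, h1 _ (by omega), h1 _ (by omega), sub_self]

theorem lpSymbol_eq (hφ : IsLPBump φ) (j : ℕ) (ξ : EuclideanSpace ℝ (Fin 2)) :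
    lpSymbol φ j ξ = lpBump φ j ξ := by
  rw [lpSymbol, (hφ.hasSum_lpBump ξ).tsum_eq, div_one]

theorem lpBump_freq_eq_zero (hφ : IsLPBump φ) {j : ℕ} {n : Fin 2 → ℤ} {i : Fin 2}
    (h : ((2 * 2 ^ j : ℕ) : ℤ) < |n i|) : lpBump φ j (freq n) = 0 := by
  refine hφ.lpBump_eq_zero_of_lt ?_
  have h1 : |(n i : ℝ)| ≤ ‖freq n‖ := PiLp.norm_apply_le (freq n) i
  have h2 : (2 * 2 ^ j : ℝ) < |(n i : ℝ)| := by exact_mod_cast h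
  linarith [pow_pos (zero_lt_two (α := ℝ)) j]

end IsLPBump

/-- The frequencies `n` with `|nᵢ| ≤ M`. -/
noncomputable def freqBox (M : ℕ) : Finset (Fin 2 → ℤ) := Fintype.piFinset fun _ => Finset.Icc (-(M : ℤ)) M

theorem mem_freqBox {M : ℕ} {n : Fin 2 → ℤ} : n ∈ freqBox M ↔ ∀ i, |n i| ≤ M := by
  simp [freqBox, abs_le]

/-- The Littlewood–Paley block `P_{2^j} u` as a continuous function. -/
noncomputable def lpBlock (φ : ℝ → ℝ) (j : ℕ) (u : TorusDistribution) : C(Torus2, ℂ) :=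
  ∑ n ∈ freqBox (2 * 2 ^ j), ((lpBump φ j (freq n) : ℂ) * distCoeff u n) • mFourier n

section LittlewoodPaley

variable {φ : ℝ → ℝ}

theorem lpBlock_apply (hφ : IsLPBump φ) (j : ℕ) (u : TorusDistribution) (x : Torus2) :
    lpBlock φ j u x = lpProj φ j u x := by
  rw [lpProj, tsum_eq_sum (s := freqBox (2 * 2 ^ j))]
  · simp [lpBlock, hφ.lpSymbol_eq]
  · intro n hn
    rw [mem_freqBox] at hn
    push Not at hn
    obtain ⟨i, hi⟩ := hn
    rw [hφ.lpSymbol_eq, hφ.lpBump_freq_eq_zero hi]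
    simp

theorem lpBlock_mem_trigPoly (φ : ℝ → ℝ) (j : ℕ) (u : TorusDistribution) :
    lpBlock φ j u ∈ trigPoly (2 * 2 ^ j) :=
  Submodule.sum_mem _ fun _ hn => Submodule.smul_mem _ _ (mFourier_mem_trigPoly (mem_freqBox.1 hn))

theorem mFourierCoeff_lpBlock (hφ : IsLPBump φ) (j : ℕ) (u : TorusDistribution)
    (n : Fin 2 → ℤ) : mFourierCoeff (lpBlock φ j u) n = lpBump φ j (freq n) * distCoeff u n := by
  rw [← mFourierCoeffCLM_apply, lpBlock, map_sum]
  simp only [map_smul, mFourierCoeffCLM_apply, mFourierCoeff_mFourier, smul_eq_mul, mul_ite,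
    mul_one, mul_zero, Finset.sum_ite_eq']
  split_ifs with h
  · rfl
  · rw [mem_freqBox] at h
    push Not at h
    obtain ⟨i, hi⟩ := h
    rw [hφ.lpBump_freq_eq_zero hi]
    simp

/-- The set where a continuous function exceeds its essential supremum is open and null, hence
empty. -/
theorem ContinuousMap.ofReal_norm_le_eLpNorm_top (f : C(Torus2, ℂ)) :
    ENNReal.ofReal ‖f‖ ≤ eLpNorm f ⊤ torusMeasure := by
  rw [eLpNorm_exponent_top]
  have hae := enorm_ae_le_eLpNormEssSup f torusMeasure
  have hopen : IsOpen {x | eLpNormEssSup f torusMeasure < ‖f x‖ₑ} :=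
    isOpen_lt continuous_const f.continuous.enorm
  have hempty := hopen.eq_empty_of_measure_zero (μ := torusMeasure) (by
    simpa [ae_iff] using hae)
  have hle (x : Torus2) : ‖f x‖ₑ ≤ eLpNormEssSup f torusMeasure := by
    by_contra! h
    exact (Set.mem_empty_iff_false x).1 (hempty ▸ h)
  by_cases ht : eLpNormEssSup f torusMeasure = ⊤
  · simp [ht]
  · refine ENNReal.ofReal_le_of_le_toReal ((ContinuousMap.norm_le _ ENNReal.toReal_nonneg).2
      fun x => ?_)
    rw [← toReal_enorm]
    exact ENNReal.toReal_mono ht (hle x)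

theorem exists_dyadicSum_of_besovHolderNorm_lt_top (hφ : IsLPBump φ) {α : ℝ} (hα : 0 < α)
    {u : TorusDistribution} (hu : besovHolderNorm φ α u < ⊤) :
    ∃ U : C(Torus2, ℂ), ofContinuous U = u ∧
      ∃ V, DyadicSum 2 α (besovHolderNorm φ α u).toReal U V := by
  set A := (besovHolderNorm φ α u).toReal
  have hnorm (j : ℕ) : ‖lpBlock φ j u‖ ≤ A * ((2 : ℝ) ^ (-α)) ^ j := by
    have h1 : ENNReal.ofReal (((2 : ℝ) ^ j) ^ α) * ENNReal.ofReal ‖lpBlock φ j u‖ ≤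
        besovHolderNorm φ α u := by
      refine le_trans (mul_le_mul_right ?_ _) (le_iSup (fun j : ℕ =>
        ENNReal.ofReal (((2 : ℝ) ^ j) ^ α) * eLpNorm (lpProj φ j u) ⊤ torusMeasure) j)
      have e : lpProj φ j u = lpBlock φ j u := funext fun x => (lpBlock_apply hφ j u x).symm
      rw [e]
      exact (lpBlock φ j u).ofReal_norm_le_eLpNorm_top
    rw [← ENNReal.ofReal_mul (by positivity), ENNReal.ofReal_le_iff_le_toReal hu.ne] at h1
    have e : ((2 : ℝ) ^ (-α)) ^ j = (((2 : ℝ) ^ j) ^ α)⁻¹ := by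
      rw [Real.rpow_neg zero_le_two, inv_pow, ← Real.rpow_mul_natCast zero_le_two,
        ← Real.rpow_natCast_mul zero_le_two, mul_comm]
    rw [e, ← div_eq_mul_inv, le_div_iff₀' (by positivity)]
    exact h1
  have hsum : Summable fun j => lpBlock φ j u :=
    (hasSum_mul_two_rpow_geometric A hα).summable.of_norm_bounded hnorm
  refine ⟨∑' j, lpBlock φ j u, ?_, _, fun j => lpBlock_mem_trigPoly φ j u, hnorm, hsum.hasSum⟩
  refine Subtype.ext (funext fun n => ?_)
  have h1 := (mFourierCoeffCLM n).hasSum hsum.hasSum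
  simp only [mFourierCoeffCLM_apply, mFourierCoeff_lpBlock hφ] at h1
  have h2 : HasSum (fun j => (lpBump φ j (freq n) : ℂ) * distCoeff u n) (1 * distCoeff u n) :=
    by
    have := Complex.hasSum_ofReal.2 (hφ.hasSum_lpBump (freq n))
    exact HasSum.mul_right _ (by simpa using this)
  rw [one_mul] at h2
  exact h1.unique h2

end LittlewoodPaley

/-! ### Products and commutators through absolute values of Fourier coefficients. -/

/-- Peetre's inequality takes `q` of the `s` powers off `k`, at the price of `⟨2πn⟩^q` and a weight
on `b`; Cauchy–Schwarz does the rest. -/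
theorem summable_conv_weight {a b : (Fin 2 → ℤ) → ℂ} {s q K L : ℝ} (hq : 0 ≤ q)
    (hb : SqSumLE (fun n => weight n ^ q * ‖b n‖) K)
    (ha : SqSumLE (fun n => weight n ^ (s - q) * ‖a n‖) L) (n : Fin 2 → ℤ) :
    Summable (fun k => ‖b (n - k)‖ * (weight k ^ s * ‖a k‖)) ∧
      ∑' k, ‖b (n - k)‖ * (weight k ^ s * ‖a k‖) ≤ 2 ^ q * weight n ^ q * (K * L) := by
  have hb' := hb.comp_injective (e := fun k => n - k) sub_right_injective
  have hle (k : Fin 2 → ℤ) : ‖b (n - k)‖ * (weight k ^ s * ‖a k‖) ≤ 2 ^ q * weight n ^ q *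
      (weight (n - k) ^ q * ‖b (n - k)‖ * (weight k ^ (s - q) * ‖a k‖)) := by
    have e : weight k ^ s = weight k ^ q * weight k ^ (s - q) := by
      rw [← Real.rpow_add (weight_pos k)]; ring_nf
    rw [e]
    calc _ = weight k ^ q * (‖b (n - k)‖ * (weight k ^ (s - q) * ‖a k‖)) := by ring
      _ ≤ 2 ^ q * (weight n ^ q * weight (n - k) ^ q) *
          (‖b (n - k)‖ * (weight k ^ (s - q) * ‖a k‖)) :=
        mul_le_mul_of_nonneg_right (weight_rpow_le k n hq) (mul_nonneg (norm_nonneg _)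
          (mul_nonneg (weight_rpow_pos _ _).le (norm_nonneg _)))
      _ = _ := by ring
  have hsum := (hb'.summable_mul ha).mul_left (2 ^ q * weight n ^ q)
  have hs : Summable (fun k => ‖b (n - k)‖ * (weight k ^ s * ‖a k‖)) :=
    hsum.of_nonneg_of_le (fun k => mul_nonneg (norm_nonneg _)
      (mul_nonneg (weight_rpow_pos _ _).le (norm_nonneg _))) hle
  refine ⟨hs, (hs.tsum_le_tsum hle hsum).trans ?_⟩
  rw [tsum_mul_left]
  exact mul_le_mul_of_nonneg_left (hb'.tsum_mul_le ha)
    (mul_nonneg (by positivity) (weight_rpow_pos _ _).le)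

theorem norm_weight_mul (s : ℝ) (n : Fin 2 → ℤ) (z : ℂ) :
    ‖((weight n ^ s : ℝ) : ℂ) * z‖ = weight n ^ s * ‖z‖ := by
  rw [norm_mul, Complex.norm_real, Real.norm_of_nonneg (weight_rpow_pos n s).le]

theorem distCoeff_bracketNabla (s : ℝ) (u : TorusDistribution) (n : Fin 2 → ℤ) :
    distCoeff (bracketNabla s u) n = ((weight n ^ s : ℝ) : ℂ) * distCoeff u n := rfl

theorem exists_isProduct_bracketNabla {f u : TorusDistribution} {s K L : ℝ} (hs : 0 ≤ s)
    (hf : SqSumLE (fun n => weight n ^ (s / 2) * ‖distCoeff f n‖) K)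
    (hu : SqSumLE (fun n => weight n ^ (s / 2) * ‖distCoeff u n‖) L) :
    ∃ w, IsProduct f (bracketNabla s u) w := by
  have hconv := summable_conv_weight (a := distCoeff u) (s := s) (by positivity) hf
    (by simpa only [sub_half] using hu)
  have hsum (n : Fin 2 → ℤ) : Summable fun k =>
      ‖distCoeff f (n - k) * distCoeff (bracketNabla s u) k‖ := by
    simpa only [norm_mul, distCoeff_bracketNabla, norm_weight_mul, Complex.norm_real,
      Real.norm_of_nonneg (weight_rpow_pos _ s).le] using (hconv n).1
  refine ⟨⟨fun n => ∑' k, distCoeff f (n - k) * distCoeff (bracketNabla s u) k,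
    2 ^ (s / 2) * (2 * Real.pi) ^ ⌈|s / 2|⌉₊ * (K * L), ⌈|s / 2|⌉₊, fun n => ?_⟩,
    fun n => (hsum n).of_norm.hasSum⟩
  refine (norm_tsum_le_tsum_norm (hsum n)).trans ?_
  have h := (hconv n).2
  simp only [norm_mul, distCoeff_bracketNabla, Complex.norm_real,
    Real.norm_of_nonneg (weight_rpow_pos _ s).le]
  refine h.trans ((mul_le_mul_of_nonneg_right (mul_le_mul_of_nonneg_left
    (japaneseBracket_two_pi_rpow_le (s / 2) (freq n)) (by positivity))
    (mul_nonneg hf.1 hu.1)).trans_eq ?_)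
  ring

theorem hasSum_sub_left {G E : Type*} [AddCommGroup G] [AddCommMonoid E] [TopologicalSpace E]
    {f : G → E} {z : E} (n : G) : HasSum (fun k => f (n - k)) z ↔ HasSum f z :=
  (Equiv.subLeft n).hasSum_iff

section Commutator

variable {f g : (Fin 2 → ℤ) → ℂ} {s r K L Z : ℝ}

/-- Cauchy–Schwarz after writing `s - r = r + (s - 2r)`. -/
theorem summable_weight_rpow_mul_norm (hf : SqSumLE (fun n => weight n ^ r * ‖f n‖) K)
    (hZ : SqSumLE (fun n => weight n ^ (s - 2 * r)) Z) :
    Summable (fun n => weight n ^ (s - r) * ‖f n‖) ∧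
      ∑' n, weight n ^ (s - r) * ‖f n‖ ≤ K * Z := by
  have e : (fun n => weight n ^ (s - r) * ‖f n‖) =
      fun n => weight n ^ r * ‖f n‖ * weight n ^ (s - 2 * r) := by
    ext n
    rw [mul_right_comm, ← Real.rpow_add (weight_pos n)]
    ring_nf
  rw [e]
  exact ⟨hf.summable_mul hZ, hf.tsum_mul_le hZ⟩

/-- In each term of the symbol bound, the factor carrying `r` powers lies in `ℓ²` and the one
carrying `s - r` powers in `ℓ¹`, so Young's inequality applies twice. -/
theorem sqSumLE_bilinear_commutator (hs : 1 ≤ s) (hr : s - 1 ≤ r)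
    (hf : SqSumLE (fun n => weight n ^ r * ‖f n‖) K)
    (hg : SqSumLE (fun n => weight n ^ r * ‖g n‖) L)
    (hZ : SqSumLE (fun n => weight n ^ (s - 2 * r)) Z) {D : (Fin 2 → ℤ) → ℂ}
    (hD : ∀ n, HasSum (fun k => (((weight n ^ s - weight (n - k) ^ s - weight k ^ s : ℝ)) : ℂ) *
      (f (n - k) * g k)) (D n)) :
    SqSumLE (fun n => ‖D n‖) ((s * 2 ^ (s - 1) + 1) * (2 * (K * L * Z))) := by
  obtain ⟨hf1, hf2⟩ := summable_weight_rpow_mul_norm hf hZ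
  obtain ⟨hg1, hg2⟩ := summable_weight_rpow_mul_norm hg hZ
  have hnn (h : (Fin 2 → ℤ) → ℂ) (q : ℝ) (k : Fin 2 → ℤ) : 0 ≤ weight k ^ q * ‖h k‖ :=
    mul_nonneg (weight_rpow_pos k q).le (norm_nonneg _)
  have hC : 0 ≤ s * 2 ^ (s - 1) + 1 := by positivity
  have h1 := (hf.conv (hnn g (s - r)) hg1.hasSum).mono_right
    (mul_le_mul_of_nonneg_left hg2 hf.1)
  have h2 := (hg.conv (hnn f (s - r)) hf1.hasSum).mono_right
    (mul_le_mul_of_nonneg_left hf2 hg.1)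
  have hs1 := summable_conv hf (hnn g (s - r)) hg1
  have hs2 := summable_conv hg (hnn f (s - r)) hf1
  have h12 := (h1.add h2).const_mul hC
  refine (h12.mono_right (le_of_eq (by ring))).mono fun n => ?_
  rw [abs_of_nonneg (norm_nonneg _), ← (hD n).tsum_eq]
  have hs2' := (hasSum_sub_left n).2 (hs2 n).hasSum
  refine tsum_of_norm_bounded (((hs1 n).hasSum.add hs2').mul_left _) fun k => ?_
  rw [norm_mul, norm_mul, Complex.norm_real, Real.norm_eq_abs, sub_sub_cancel]
  have h := abs_weight_add_rpow_sub_le (n - k) k hs hr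
  rw [sub_add_cancel] at h
  refine (mul_le_mul_of_nonneg_right h (by positivity)).trans_eq ?_
  ring

/-- Here `b = a * a` and `c = b * a`. The sequence splits into the bilinear commutator of `b` and
`a`, plus the convolution of `a` with the bilinear commutator of `a` with itself; Young's inequality
bounds the second part, as `a` is in `ℓ¹`. -/
theorem sqSumLE_cubic_commutator {a b c w : (Fin 2 → ℤ) → ℂ} (hs : 1 ≤ s) (hr : s - 1 ≤ r)
    (hsr : s / 2 ≤ r) (hrs : r ≤ s)
    (ha : SqSumLE (fun n => weight n ^ r * ‖a n‖) K)
    (hb : SqSumLE (fun n => weight n ^ r * ‖b n‖) L)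
    (hZ : SqSumLE (fun n => weight n ^ (s - 2 * r)) Z)
    (haa : ∀ n, HasSum (fun k => a (n - k) * a k) (b n))
    (hba : ∀ n, HasSum (fun k => b (n - k) * a k) (c n))
    (hw : ∀ n, HasSum (fun k => b (n - k) * (((weight k ^ s : ℝ) : ℂ) * a k)) (w n)) :
    SqSumLE (fun n => ‖((weight n ^ s : ℝ) : ℂ) * c n - 3 * w n‖)
      ((s * 2 ^ (s - 1) + 1) * (2 * (L * K * Z)) +
        (s * 2 ^ (s - 1) + 1) * (2 * (K * K * Z)) * (K * Z)) := by
  have hsr0 : 0 ≤ s - r := by linarith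
  have hmono {f : (Fin 2 → ℤ) → ℂ} {K : ℝ} (hf : SqSumLE (fun n => weight n ^ r * ‖f n‖) K) :
      SqSumLE (fun n => weight n ^ (s - r) * ‖f n‖) K := hf.mono fun n => by
    rw [abs_of_nonneg (mul_nonneg (weight_rpow_pos _ _).le (norm_nonneg _))]
    exact mul_le_mul_of_nonneg_right
      (Real.rpow_le_rpow_of_exponent_le (one_le_weight n) (by linarith)) (norm_nonneg _)
  have ha' : SqSumLE (fun n => weight n ^ (s - (s - r)) * ‖a n‖) K := by
    simpa only [sub_sub_cancel] using ha
  have hconv {f g : (Fin 2 → ℤ) → ℂ} {K L : ℝ} (hf : SqSumLE (fun n => weight n ^ r * ‖f n‖) K)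
      (hg : SqSumLE (fun n => weight n ^ r * ‖g n‖) L) (n : Fin 2 → ℤ) :
      Summable fun k => f (n - k) * (((weight k ^ s : ℝ) : ℂ) * g k) := by
    refine Summable.of_norm ?_
    simpa only [norm_mul, Complex.norm_real, Real.norm_of_nonneg (weight_rpow_pos _ s).le] using
      (summable_conv_weight hsr0 (hmono hf) (by simpa only [sub_sub_cancel] using hg) n).1
  set v : (Fin 2 → ℤ) → ℂ := fun n => ∑' k, a (n - k) * (((weight k ^ s : ℝ) : ℂ) * a k) with hv
  have hv' (n : Fin 2 → ℤ) : HasSum (fun k => a (n - k) * (((weight k ^ s : ℝ) : ℂ) * a k)) (v n) :=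
    (hconv ha ha n).hasSum
  obtain ⟨ha1, ha2⟩ := summable_weight_rpow_mul_norm ha hZ
  -- Associativity `(a * Λa) * a = (a * a) * Λa`, by Fubini for an absolutely convergent double
  -- series. A second use of Peetre's inequality leaves `⟨2πk⟩^{s-r} ‖a k‖`, which is summable.
  have hva (n : Fin 2 → ℤ) : HasSum (fun k => v (n - k) * a k) (w n) := by
    have hF : Summable fun p : (Fin 2 → ℤ) × (Fin 2 → ℤ) =>
        a (n - p.1 - p.2) * (((weight p.2 ^ s : ℝ) : ℂ) * a p.2) * a p.1 := by
      refine Summable.of_norm ((summable_prod_of_nonneg fun _ => norm_nonneg _).2 ⟨fun k => ?_, ?_⟩)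
      · exact ((hconv ha ha (n - k)).mul_right (a k)).norm
      · simp only [norm_mul _ (a _)]
        simp only [tsum_mul_right]
        refine ((ha1.mul_left (2 ^ (s - r) * (2 ^ (s - r) * weight n ^ (s - r)) * (K * K))).of_nonneg_of_le
          (fun k => mul_nonneg (tsum_nonneg fun _ => norm_nonneg _) (norm_nonneg _)) fun k => ?_)
        have h1 := (summable_conv_weight hsr0 (hmono ha) ha' (n - k)).2
        have h2 := weight_rpow_le (n - k) n hsr0
        rw [sub_sub_cancel] at h2
        simp only [norm_mul, Complex.norm_real, Real.norm_of_nonneg (weight_rpow_pos _ s).le]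
        calc _ ≤ 2 ^ (s - r) * (2 ^ (s - r) * (weight n ^ (s - r) * weight k ^ (s - r))) * (K * K) *
              ‖a k‖ := by
              refine mul_le_mul_of_nonneg_right (h1.trans ?_) (norm_nonneg _)
              have := mul_nonneg ha.1 ha.1
              gcongr
          _ = _ := by ring
    have h1 := hF.hasSum.prod_fiberwise (g := fun k => v (n - k) * a k) fun k =>
      (hv' (n - k)).mul_right (a k)
    have h2 := ((Equiv.prodComm _ _).hasSum_iff.2 hF.hasSum).prod_fiberwise
      (g := fun l => b (n - l) * (((weight l ^ s : ℝ) : ℂ) * a l)) fun l => by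
        have := (haa (n - l)).mul_right (((weight l ^ s : ℝ) : ℂ) * a l)
        convert! this using 2 with k
        simp only [Function.comp_apply, Equiv.prodComm_apply, Prod.fst_swap, Prod.snd_swap]
        rw [sub_right_comm]
        ring
    rwa [h2.unique (hw n)] at h1
  set d : (Fin 2 → ℤ) → ℂ := fun n => ((weight n ^ s : ℝ) : ℂ) * b n - v n - v n with hd
  have hdsum (n : Fin 2 → ℤ) : HasSum (fun k =>
      (((weight n ^ s - weight (n - k) ^ s - weight k ^ s : ℝ)) : ℂ) * (a (n - k) * a k)) (d n) := by
    have h2 := (hasSum_sub_left n).2 (hv' n)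
    convert! (((haa n).mul_left ((weight n ^ s : ℝ) : ℂ)).sub h2).sub (hv' n) using 2 with k
    rw [sub_sub_cancel]
    push_cast
    ring
  have hdle := sqSumLE_bilinear_commutator hs hr ha ha hZ hdsum
  have hbw (n : Fin 2 → ℤ) : Summable fun k => ((weight (n - k) ^ s : ℝ) : ℂ) * b (n - k) * a k := by
    have := (hasSum_sub_left n).2 (hconv ha hb n).hasSum
    refine this.summable.congr fun k => ?_
    rw [sub_sub_cancel]
    ring
  set D : (Fin 2 → ℤ) → ℂ := fun n => ((weight n ^ s : ℝ) : ℂ) * c n -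
    (∑' k, ((weight (n - k) ^ s : ℝ) : ℂ) * b (n - k) * a k) - w n with hD
  have hDsum (n : Fin 2 → ℤ) : HasSum (fun k =>
      (((weight n ^ s - weight (n - k) ^ s - weight k ^ s : ℝ)) : ℂ) * (b (n - k) * a k)) (D n) := by
    convert! (((hba n).mul_left ((weight n ^ s : ℝ) : ℂ)).sub (hbw n).hasSum).sub (hw n)
      using 2 with k
    push_cast
    ring
  have hDle := sqSumLE_bilinear_commutator hs hr hb ha hZ hDsum
  have hda (n : Fin 2 → ℤ) : HasSum (fun k => d (n - k) * a k)
      ((∑' k, ((weight (n - k) ^ s : ℝ) : ℂ) * b (n - k) * a k) - w n - w n) := by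
    convert! ((hbw n).hasSum.sub (hva n)).sub (hva n) using 2 with k
    simp only [hd]
    ring
  have hnorm (k : Fin 2 → ℤ) : ‖a k‖ ≤ weight k ^ (s - r) * ‖a k‖ :=
    le_mul_of_one_le_left (norm_nonneg _) (Real.one_le_rpow (one_le_weight k) hsr0)
  have hs1 : Summable fun k => ‖a k‖ := ha1.of_nonneg_of_le (fun _ => norm_nonneg _) hnorm
  have hconvle := (hdle.conv (fun k => norm_nonneg (a k)) hs1.hasSum).mono_right
    (mul_le_mul_of_nonneg_left ((hs1.tsum_le_tsum hnorm ha1).trans ha2) hdle.1)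
  refine (hDle.add hconvle).mono fun n => ?_
  rw [abs_of_nonneg (norm_nonneg _)]
  have e : ((weight n ^ s : ℝ) : ℂ) * c n - 3 * w n = D n +
      ((∑' k, ((weight (n - k) ^ s : ℝ) : ℂ) * b (n - k) * a k) - w n - w n) := by
    simp only [hD]; ring
  rw [e]
  refine (norm_add_le _ _).trans (add_le_add le_rfl ?_)
  rw [← (hda n).tsum_eq]
  exact tsum_of_norm_bounded (summable_conv hdle (fun k => norm_nonneg (a k)) hs1 n).hasSum
    fun k => (norm_mul _ _).le

end Commutator

/-! ### Subordination: fractional powers from exponentials. -/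

theorem integrableOn_min_one_rpow_mul {σ β : ℝ} (hσ : 0 < σ) (hβ : σ < β) :
    IntegrableOn (fun t : ℝ => min 1 (t ^ β) * t ^ (-1 - σ)) (Set.Ioi 0) := by
  rw [← Set.Ioc_union_Ioi_eq_Ioi zero_le_one]
  refine IntegrableOn.union ?_ ?_
  · have h : IntegrableOn (fun t : ℝ => t ^ (β - 1 - σ)) (Set.Ioc 0 1) := by
      rw [← intervalIntegrable_iff_integrableOn_Ioc_of_le zero_le_one]
      exact intervalIntegral.intervalIntegrable_rpow' (by linarith)
    refine h.congr_fun (fun t ht => ?_) measurableSet_Ioc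
    have h1 : t ^ β ≤ 1 := Real.rpow_le_one ht.1.le ht.2 (by linarith)
    simp only [min_eq_right h1]
    rw [← Real.rpow_add ht.1]
    ring_nf
  · refine (integrableOn_Ioi_rpow_of_lt (a := -1 - σ) (by linarith) zero_lt_one).congr_fun
      (fun t ht => ?_) measurableSet_Ioi
    have h1 : 1 ≤ t ^ β := Real.one_le_rpow (le_of_lt ht) (by linarith)
    simp only [min_eq_left h1, one_mul]

theorem one_sub_exp_neg_mul_nonneg {t lam : ℝ} (ht : 0 ≤ t) (hlam : 0 ≤ lam) :
    0 ≤ 1 - Real.exp (-(t * lam)) :=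
  sub_nonneg.2 (Real.exp_le_one_iff.2 (by nlinarith))

theorem integrableOn_one_sub_exp_mul_rpow {σ lam : ℝ} (hσ : 0 < σ) (hσ1 : σ < 1) (hlam : 0 ≤ lam) :
    IntegrableOn (fun t : ℝ => (1 - Real.exp (-(t * lam))) * t ^ (-1 - σ)) (Set.Ioi 0) := by
  refine ((integrableOn_min_one_rpow_mul hσ hσ1).const_mul (1 + lam)).mono' ?_ ?_
  · exact Measurable.aestronglyMeasurable (by fun_prop)
  · refine (ae_restrict_iff' measurableSet_Ioi).2 (.of_forall fun t ht => ?_)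
    have ht0 : 0 < t := ht
    rw [norm_mul, Real.norm_of_nonneg (Real.rpow_nonneg ht0.le _),
      Real.norm_of_nonneg (one_sub_exp_neg_mul_nonneg ht0.le hlam), ← mul_assoc, Real.rpow_one]
    refine mul_le_mul_of_nonneg_right ?_ (Real.rpow_nonneg ht0.le _)
    rw [mul_min_of_nonneg _ _ (by linarith)]
    refine le_min ?_ ?_
    · linarith [Real.exp_pos (-(t * lam))]
    · nlinarith [Real.add_one_le_exp (-(t * lam))]

/-- The constant `∫₀^∞ (1 - e^{-t}) t^{-1-σ} dt`. -/
noncomputable def subordinationConst (σ : ℝ) : ℝ :=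
  ∫ t in Set.Ioi (0 : ℝ), (1 - Real.exp (-t)) * t ^ (-1 - σ)

theorem subordinationConst_pos {σ : ℝ} (hσ : 0 < σ) (hσ1 : σ < 1) : 0 < subordinationConst σ := by
  have hpos (t : ℝ) (ht : 0 < t) : 0 < (1 - Real.exp (-t)) * t ^ (-1 - σ) :=
    mul_pos (sub_pos.2 (Real.exp_lt_one_iff.2 (neg_neg_of_pos ht))) (Real.rpow_pos_of_pos ht _)
  rw [subordinationConst, setIntegral_pos_iff_support_of_nonneg_ae]
  · have : Function.support (fun t : ℝ => (1 - Real.exp (-t)) * t ^ (-1 - σ)) ∩ Set.Ioi 0 =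
        Set.Ioi 0 := Set.inter_eq_right.2 fun t ht => (hpos t ht).ne'
    rw [this]
    simp
  · exact (ae_restrict_iff' measurableSet_Ioi).2 (.of_forall fun t ht => (hpos t ht).le)
  · simpa using integrableOn_one_sub_exp_mul_rpow hσ hσ1 zero_le_one

/-- The substitution `t ↦ t / lam`. It is used with `lam = ⟨2πk⟩²` and `σ = s/2`, giving the symbol
`⟨2πk⟩^s`. -/
theorem integral_one_sub_exp_mul_rpow (σ : ℝ) {lam : ℝ} (hlam : 0 < lam) :
    ∫ t in Set.Ioi (0 : ℝ), (1 - Real.exp (-(t * lam))) * t ^ (-1 - σ) =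
      lam ^ σ * subordinationConst σ := by
  have h := integral_comp_mul_left_Ioi (fun t : ℝ => (1 - Real.exp (-t)) * t ^ (-1 - σ)) 0 hlam
  rw [mul_zero] at h
  have e : ∫ t in Set.Ioi (0 : ℝ), (1 - Real.exp (-(lam * t))) * (lam * t) ^ (-1 - σ) =
      lam ^ (-1 - σ) * ∫ t in Set.Ioi (0 : ℝ), (1 - Real.exp (-(t * lam))) * t ^ (-1 - σ) := by
    rw [← integral_const_mul]
    refine setIntegral_congr_fun measurableSet_Ioi fun t ht => ?_
    rw [Real.mul_rpow hlam.le (le_of_lt ht), mul_comm lam t]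
    ring
  rw [e, smul_eq_mul] at h
  have e2 : lam ^ (-1 - σ) = lam⁻¹ * (lam ^ σ)⁻¹ := by
    rw [← Real.rpow_neg hlam.le, ← Real.rpow_neg_one lam, ← Real.rpow_add hlam]
    ring_nf
  rw [e2, mul_assoc] at h
  have h3 := mul_left_cancel₀ (inv_ne_zero hlam.ne') h
  rw [inv_mul_eq_iff_eq_mul₀ (Real.rpow_pos_of_pos hlam σ).ne'] at h3
  exact h3

/-! ### The damped heat semigroup as a Gaussian average. -/

theorem mFourier_add_apply (n : Fin 2 → ℤ) (x y : Torus2) :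
    mFourier n (x + y) = mFourier n x * mFourier n y := by
  simp [mFourier, Fin.prod_univ_two, fourier_apply, smul_add, AddCircle.toCircle_add]
  ring

theorem mFourier_torusMk (n : Fin 2 → ℤ) (y : EuclideanSpace ℝ (Fin 2)) :
    mFourier n (torusMk y) = Complex.exp (inner ℝ y ((2 * Real.pi) • freq n) * Complex.I) := by
  simp only [mFourier, ContinuousMap.coe_mk, Fin.prod_univ_two, torusMk]
  rw [fourier_coe_apply, fourier_coe_apply, ← Complex.exp_add]
  congr 1
  simp [PiLp.inner_apply, Fin.sum_univ_two, freq]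
  ring

/-- The standard Gaussian measure on `ℝ²`. -/
noncomputable abbrev gaussian2 : Measure (EuclideanSpace ℝ (Fin 2)) :=
  stdGaussian (EuclideanSpace ℝ (Fin 2))

/-- The characteristic function of a Gaussian; the scale `√(2t)` turns `e^{-|ξ|²/2}` into
`e^{-t|ξ|²}`. -/
theorem integral_mFourier_torusMk (n : Fin 2 → ℤ) {t : ℝ} (ht : 0 ≤ t) :
    ∫ z, mFourier n (torusMk (√(2 * t) • z)) ∂gaussian2 =
      Complex.exp (-(t * ‖(2 * Real.pi) • freq n‖ ^ 2 : ℝ)) := by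
  have h := charFun_stdGaussian (E := EuclideanSpace ℝ (Fin 2))
    (√(2 * t) • (2 * Real.pi) • freq n)
  rw [charFun_apply] at h
  simp only [mFourier_torusMk, real_inner_smul_left, real_inner_smul_right _ _ √(2 * t)] at h ⊢
  rw [h, norm_smul (√(2 * t)), Real.norm_of_nonneg (Real.sqrt_nonneg _)]
  congr 1
  have h2 : √(2 * t) ^ 2 = 2 * t := Real.sq_sqrt (by linarith)
  have h3 : ((√(2 * t) : ℝ) : ℂ) ^ 2 = 2 * t := by exact_mod_cast h2
  push_cast
  rw [mul_pow, h3]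
  ring

/-- The translates `f (x + √(2t) z)` as a continuous function of `(t, x, z)`. -/
theorem continuous_heat_integrand (f : C(Torus2, ℂ)) :
    Continuous fun p : ℝ × Torus2 × EuclideanSpace ℝ (Fin 2) =>
      f (p.2.1 + torusMk (√(2 * p.1) • p.2.2)) := by
  have := continuous_torusMk
  fun_prop

/-- The heat semigroup `e^{-t(1-Δ)} f`, for `t ≥ 0`. -/
noncomputable def dampedHeat (f : C(Torus2, ℂ)) (t : ℝ) (x : Torus2) : ℂ :=
  (Real.exp (-t) : ℂ) * ∫ z, f (x + torusMk (√(2 * t) • z)) ∂gaussian2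

theorem integrable_heat_integrand (f : C(Torus2, ℂ)) (t : ℝ) (x : Torus2) :
    Integrable (fun z => f (x + torusMk (√(2 * t) • z))) gaussian2 := by
  have hc : Continuous fun z => f (x + torusMk (√(2 * t) • z)) :=
    (continuous_heat_integrand f).comp (by fun_prop : Continuous fun z => (t, x, z))
  exact Integrable.of_bound hc.aestronglyMeasurable ‖f‖ (.of_forall fun z => f.norm_coe_le_norm _)

theorem continuous_dampedHeat (f : C(Torus2, ℂ)) :
    Continuous fun p : ℝ × Torus2 => dampedHeat f p.1 p.2 := by
  have h : Continuous fun p : ℝ × Torus2 =>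
      ∫ z, f (p.2 + torusMk (√(2 * p.1) • z)) ∂gaussian2 := by
    refine continuous_of_dominated (bound := fun _ => ‖f‖)
      (fun p => (integrable_heat_integrand f p.1 p.2).aestronglyMeasurable)
      (fun p => .of_forall fun z => f.norm_coe_le_norm _) (integrable_const _)
      (.of_forall fun z => ?_)
    exact (continuous_heat_integrand f).comp
      (by fun_prop : Continuous fun p : ℝ × Torus2 => (p.1, p.2, z))
  unfold dampedHeat
  fun_prop

theorem continuous_dampedHeat_right (f : C(Torus2, ℂ)) (t : ℝ) : Continuous (dampedHeat f t) :=
  (continuous_dampedHeat f).comp (by fun_prop : Continuous fun x => (t, x))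

theorem norm_dampedHeat_le (f : C(Torus2, ℂ)) {t : ℝ} (ht : 0 ≤ t) (x : Torus2) :
    ‖dampedHeat f t x‖ ≤ ‖f‖ := by
  rw [dampedHeat, norm_mul, Complex.norm_real, Real.norm_of_nonneg (Real.exp_pos _).le]
  refine (mul_le_of_le_one_left (norm_nonneg _) (Real.exp_le_one_iff.2 (by linarith))).trans ?_
  refine (norm_integral_le_of_norm_le_const (C := ‖f‖)
    (.of_forall fun z => f.norm_coe_le_norm _)).trans (by simp)

theorem mFourierCoeff_comp_add (f : C(Torus2, ℂ)) (a : Torus2) (n : Fin 2 → ℤ) :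
    ∫ x, mFourier (-n) x * f (x + a) ∂torusMeasure = mFourier n a * mFourierCoeff f n := by
  rw [mFourierCoeff_eq_integral_torusMeasure,
    ← integral_add_right_eq_self (μ := torusMeasure) (fun t => mFourier (-n) t * f t) a,
    ← integral_const_mul]
  refine integral_congr_ae (.of_forall fun x => ?_)
  have h : mFourier n a * mFourier (-n) a = 1 := by
    rw [← mFourier_add, add_neg_cancel, mFourier_zero, ContinuousMap.one_apply]
  simp only [mFourier_add_apply]
  linear_combination (-(mFourier (-n) x * f (x + a))) * h

theorem mFourierCoeff_dampedHeat (f : C(Torus2, ℂ)) {t : ℝ} (ht : 0 ≤ t) (n : Fin 2 → ℤ) :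
    mFourierCoeff (dampedHeat f t) n =
      (Real.exp (-(t * weight n ^ 2)) : ℂ) * mFourierCoeff f n := by
  have hint : Integrable (fun p : Torus2 × EuclideanSpace ℝ (Fin 2) =>
      mFourier (-n) p.1 * f (p.1 + torusMk (√(2 * t) • p.2))) (torusMeasure.prod gaussian2) := by
    have hc : Continuous fun p : Torus2 × EuclideanSpace ℝ (Fin 2) =>
        mFourier (-n) p.1 * f (p.1 + torusMk (√(2 * t) • p.2)) :=
      (by fun_prop : Continuous fun p : Torus2 × EuclideanSpace ℝ (Fin 2) => mFourier (-n) p.1).mul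
        ((continuous_heat_integrand f).comp
          (by fun_prop : Continuous fun p : Torus2 × EuclideanSpace ℝ (Fin 2) => (t, p.1, p.2)))
    refine Integrable.of_bound hc.aestronglyMeasurable ‖f‖ (.of_forall fun p => ?_)
    rw [norm_mul, norm_mFourier_apply, one_mul]
    exact f.norm_coe_le_norm _
  rw [mFourierCoeff_eq_integral_torusMeasure]
  simp only [dampedHeat, mul_left_comm (mFourier (-n) _)]
  simp only [← integral_const_mul (mFourier (-n) _)]
  rw [integral_const_mul, integral_integral_swap hint]
  simp only [mFourierCoeff_comp_add]
  rw [integral_mul_const, integral_mFourier_torusMk n ht, ← mul_assoc, weight_sq,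
    Complex.ofReal_exp, Complex.ofReal_exp, ← Complex.exp_add]
  congr 2
  push_cast
  ring

theorem rpow_sq_le_one_add_sq {z β : ℝ} (hz : 0 ≤ z) (hβ : 0 ≤ β) (hβ1 : β ≤ 1) :
    (z ^ β) ^ 2 ≤ 1 + z ^ 2 := by
  rcases le_total z 1 with h | h
  · have := pow_le_pow_left₀ (Real.rpow_nonneg hz β) (Real.rpow_le_one hz h hβ) 2
    nlinarith [sq_nonneg z]
  · have h1 : z ^ β ≤ z := by simpa using Real.rpow_le_rpow_of_exponent_le h hβ1
    have := pow_le_pow_left₀ (Real.rpow_nonneg hz β) h1 2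
    linarith

theorem integrable_norm_rpow_sq_gaussian2 {β : ℝ} (hβ : 0 ≤ β) (hβ1 : β ≤ 1) :
    Integrable (fun z => (‖z‖ ^ β) ^ 2) gaussian2 := by
  have h : Integrable (fun z : EuclideanSpace ℝ (Fin 2) => ‖z‖ ^ 2) gaussian2 := by
    simpa using (IsGaussian.memLp_two_id (μ := gaussian2)).integrable_norm_pow two_ne_zero
  refine ((integrable_const (1 : ℝ)).add h).mono' (by fun_prop) (.of_forall fun z => ?_)
  rw [Real.norm_of_nonneg (by positivity)]
  exact rpow_sq_le_one_add_sq (norm_nonneg z) hβ hβ1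

/-! ### The commutator with the heat semigroup and its integral in time. -/

/-- The commutator `U³ - P U³ - 3 U² (U - P U)`, where `P` is the heat semigroup at time `t`. -/
noncomputable def heatCommutator (U : C(Torus2, ℂ)) (t : ℝ) (x : Torus2) : ℂ :=
  U x ^ 3 - dampedHeat (U ^ 3) t x - 3 * (U x ^ 2 * (U x - dampedHeat U t x))

theorem continuous_heatCommutator (U : C(Torus2, ℂ)) :
    Continuous fun p : ℝ × Torus2 => heatCommutator U p.1 p.2 := by
  have h1 := continuous_dampedHeat (U ^ 3)
  have h2 := continuous_dampedHeat U
  unfold heatCommutator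
  fun_prop

theorem continuous_heatCommutator_right (U : C(Torus2, ℂ)) (t : ℝ) :
    Continuous (heatCommutator U t) := by
  have h1 := continuous_dampedHeat_right (U ^ 3) t
  have h2 := continuous_dampedHeat_right U t
  unfold heatCommutator
  fun_prop

/-- Averaging `a³ - b³ - 3a²(a - b) = -(a - b)²(2a + b)` over the Gaussian accounts for the mass
`e^{-t}` of the damped kernel. The missing mass `1 - e^{-t}` multiplies `a³ - 3a³ = -2a³`. -/
theorem heatCommutator_eq (U : C(Torus2, ℂ)) (t : ℝ) (x : Torus2) :
    heatCommutator U t x = (1 - Real.exp (-t) : ℝ) * (-2 * U x ^ 3) - Real.exp (-t) *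
      ∫ z, (U x - U (x + torusMk (√(2 * t) • z))) ^ 2 *
        (2 * U x + U (x + torusMk (√(2 * t) • z))) ∂gaussian2 := by
  have h1 := integrable_heat_integrand U t x
  have h3 := integrable_heat_integrand (U ^ 3) t x
  have e (z : EuclideanSpace ℝ (Fin 2)) : (U x - U (x + torusMk (√(2 * t) • z))) ^ 2 *
      (2 * U x + U (x + torusMk (√(2 * t) • z))) =
      2 * U x ^ 3 - 3 * U x ^ 2 * U (x + torusMk (√(2 * t) • z)) +
        (U ^ 3) (x + torusMk (√(2 * t) • z)) := by
    rw [ContinuousMap.pow_apply]; ring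
  simp only [e]
  have h2 : Integrable (fun z => 2 * U x ^ 3 - 3 * U x ^ 2 * U (x + torusMk (√(2 * t) • z)))
      gaussian2 := (integrable_const _).sub (h1.const_mul _)
  rw [integral_add h2 h3, integral_sub (integrable_const _) (h1.const_mul _), integral_const_mul (3 * U x ^ 2)]
  simp only [heatCommutator, dampedHeat, integral_const, probReal_univ, one_smul]
  push_cast
  ring

/-- For `t ≥ 1` each term is bounded trivially, with total `8K³`. For `t ≤ 1` the squared increment
is at most `K² (2t)^β ‖z‖^{2β}`, whose Gaussian mean is finite, and the missing mass is at most `t ≤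
t^β`. -/
theorem norm_heatCommutator_le {U : C(Torus2, ℂ)} {K β : ℝ} (hβ : 0 ≤ β) (hβ1 : β ≤ 1)
    (hK : ‖U‖ ≤ K) (hU : ∀ x y, ‖U (x + torusMk y) - U x‖ ≤ K * ‖y‖ ^ β) {t : ℝ} (ht : 0 < t)
    (x : Torus2) : ‖heatCommutator U t x‖ ≤
      (8 + 6 * ∫ z, (‖z‖ ^ β) ^ 2 ∂gaussian2) * K ^ 3 * min 1 (t ^ β) := by
  set m := ∫ z, (‖z‖ ^ β) ^ 2 ∂gaussian2 with hm
  have hm0 : 0 ≤ m := integral_nonneg fun z => by positivity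
  have hK0 : 0 ≤ K := (norm_nonneg _).trans hK
  have hUx (x : Torus2) : ‖U x‖ ≤ K := (U.norm_coe_le_norm x).trans hK
  have hU3 : ‖U ^ 3‖ ≤ K ^ 3 := (norm_pow_le' U (by norm_num)).trans (by gcongr)
  rcases le_total 1 t with ht1 | ht1
  · rw [min_eq_left (Real.one_le_rpow ht1 hβ), mul_one]
    calc ‖heatCommutator U t x‖ ≤ ‖U x ^ 3‖ + ‖dampedHeat (U ^ 3) t x‖ +
          3 * (‖U x‖ ^ 2 * (‖U x‖ + ‖dampedHeat U t x‖)) := by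
          refine (norm_sub_le _ _).trans (add_le_add (norm_sub_le _ _) ?_)
          rw [norm_mul, norm_mul, norm_pow, RCLike.norm_ofNat]
          gcongr
          exact norm_sub_le _ _
      _ ≤ K ^ 3 + K ^ 3 + 3 * (K ^ 2 * (K + K)) := by
          rw [norm_pow]
          have h1 := hUx x
          have h2 := (norm_dampedHeat_le U ht.le x).trans hK
          have h3 := (norm_dampedHeat_le (U ^ 3) ht.le x).trans hU3
          gcongr
      _ = 8 * K ^ 3 := by ring
      _ ≤ _ := by gcongr; linarith
  · rw [min_eq_right (Real.rpow_le_one ht.le ht1 hβ), heatCommutator_eq]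
    have htβ : t ≤ t ^ β := by simpa using Real.rpow_le_rpow_of_exponent_ge ht ht1 hβ1
    have hexp0 : 0 ≤ 1 - Real.exp (-t) := by
      simpa using one_sub_exp_neg_mul_nonneg ht.le zero_le_one
    have hexp : 1 - Real.exp (-t) ≤ t := by linarith [Real.add_one_le_exp (-t)]
    have h1 : ‖((1 - Real.exp (-t) : ℝ) : ℂ) * (-2 * U x ^ 3)‖ ≤ 2 * K ^ 3 * t ^ β := by
      rw [norm_mul, Complex.norm_real, Real.norm_of_nonneg hexp0, norm_mul, norm_neg,
        RCLike.norm_ofNat, norm_pow]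
      calc _ ≤ t ^ β * (2 * K ^ 3) := by
            have := hUx x
            gcongr
            linarith
        _ = _ := by ring
    have h2 : ‖∫ z, (U x - U (x + torusMk (√(2 * t) • z))) ^ 2 *
        (2 * U x + U (x + torusMk (√(2 * t) • z))) ∂gaussian2‖ ≤ 6 * m * K ^ 3 * t ^ β := by
      have hb (z : EuclideanSpace ℝ (Fin 2)) : ‖(U x - U (x + torusMk (√(2 * t) • z))) ^ 2 *
          (2 * U x + U (x + torusMk (√(2 * t) • z)))‖ ≤ 6 * K ^ 3 * t ^ β * (‖z‖ ^ β) ^ 2 := by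
        have ha := hU x (√(2 * t) • z)
        rw [norm_sub_rev, norm_smul, Real.norm_of_nonneg (Real.sqrt_nonneg _),
          Real.mul_rpow (Real.sqrt_nonneg _) (norm_nonneg _)] at ha
        have hb : ‖2 * U x + U (x + torusMk (√(2 * t) • z))‖ ≤ 3 * K := by
          refine (norm_add_le _ _).trans ?_
          rw [norm_mul, RCLike.norm_ofNat]
          linarith [hUx x, hUx (x + torusMk (√(2 * t) • z))]
        have hc : (√(2 * t) ^ β) ^ 2 ≤ 2 * t ^ β := by
          rw [← Real.rpow_natCast, ← Real.rpow_mul (Real.sqrt_nonneg _), mul_comm β,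
            Real.rpow_mul (Real.sqrt_nonneg _), Real.rpow_natCast,
            Real.sq_sqrt (by linarith), Real.mul_rpow zero_le_two ht.le]
          gcongr
          simpa using Real.rpow_le_rpow_of_exponent_le one_le_two hβ1
        rw [norm_mul, norm_pow]
        calc _ ≤ (K * (√(2 * t) ^ β * ‖z‖ ^ β)) ^ 2 * (3 * K) := by gcongr
          _ = 3 * K ^ 3 * (√(2 * t) ^ β) ^ 2 * (‖z‖ ^ β) ^ 2 := by ring
          _ ≤ 3 * K ^ 3 * (2 * t ^ β) * (‖z‖ ^ β) ^ 2 := by gcongr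
          _ = _ := by ring
      refine (norm_integral_le_of_norm_le
        ((integrable_norm_rpow_sq_gaussian2 hβ hβ1).const_mul _) (.of_forall hb)).trans_eq ?_
      rw [integral_const_mul]
      ring
    refine (norm_sub_le _ _).trans ?_
    rw [norm_mul (Real.exp (-t) : ℂ), Complex.norm_real, Real.norm_of_nonneg (Real.exp_pos _).le]
    have h3 := mul_le_of_le_one_left (norm_nonneg (∫ z, (U x - U (x + torusMk (√(2 * t) • z))) ^ 2 *
        (2 * U x + U (x + torusMk (√(2 * t) • z))) ∂gaussian2))
        (Real.exp_le_one_iff.2 (neg_nonpos.2 ht.le))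
    have h4 : 0 ≤ K ^ 3 * t ^ β := by positivity
    calc _ ≤ 2 * K ^ 3 * t ^ β + 6 * m * K ^ 3 * t ^ β := add_le_add h1 (h3.trans h2)
      _ ≤ _ := by nlinarith

theorem hasSum_mFourierCoeff_heatCommutator (U : C(Torus2, ℂ)) {t : ℝ} (ht : 0 ≤ t)
    (n : Fin 2 → ℤ) :
    HasSum (fun k => ((1 - Real.exp (-(t * weight k ^ 2)) : ℝ) : ℂ) *
        (mFourierCoeff (U ^ 2 : C(Torus2, ℂ)) (n - k) * mFourierCoeff U k))
      (3⁻¹ * (((1 - Real.exp (-(t * weight n ^ 2)) : ℝ) : ℂ) * mFourierCoeff (U ^ 3 : C(Torus2, ℂ)) n -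
        mFourierCoeff (heatCommutator U t) n)) := by
  let P (f : C(Torus2, ℂ)) : C(Torus2, ℂ) := ⟨dampedHeat f t, continuous_dampedHeat_right f t⟩
  have hP (f : C(Torus2, ℂ)) (k : Fin 2 → ℤ) : mFourierCoeffCLM k (P f) =
      (Real.exp (-(t * weight k ^ 2)) : ℂ) * mFourierCoeff f k := mFourierCoeff_dampedHeat f ht k
  have e1 : heatCommutator U t = (U ^ 3 - P (U ^ 3) - (3 : ℂ) • (U ^ 2 * (U - P U)) :
      C(Torus2, ℂ)) := by
    ext x; simp [heatCommutator, P]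
  have h := hasSum_mFourierCoeff_mul (U ^ 2) (U - P U) n
  rw [e1]
  simp only [← mFourierCoeffCLM_apply] at h ⊢
  convert! h using 1
  · ext k
    simp only [map_sub, hP]
    push_cast
    simp only [mFourierCoeffCLM_apply]
    ring
  · rw [map_sub, map_sub, map_smul, hP]
    simp only [Complex.ofReal_sub, Complex.ofReal_one, mFourierCoeffCLM_apply, smul_eq_mul]
    ring

/-- The function `g` is `c⁻¹ ∫₀^∞ t^{-1-s/2} heatCommutator U t dt`. The integrand is at most a
constant times `K³ min(1, t^β) t^{-1-s/2}`, integrable because `0 < s/2 < β`. Its coefficients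
follow from Fubini and from subordination applied to each frequency. -/
theorem exists_commutator_of_holder {s β : ℝ} (hs : 0 < s) (hs2 : s < 2) (hβ : s / 2 < β)
    (hβ1 : β ≤ 1) :
    ∃ C : ℝ, 0 ≤ C ∧ ∀ (U : C(Torus2, ℂ)) (K L M : ℝ) (W : (Fin 2 → ℤ) → ℂ), ‖U‖ ≤ K →
      (∀ x y, ‖U (x + torusMk y) - U x‖ ≤ K * ‖y‖ ^ β) →
      SqSumLE (fun n => weight n ^ (s / 2) * ‖mFourierCoeff (U ^ 2 : C(Torus2, ℂ)) n‖) L →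
      SqSumLE (fun n => weight n ^ (s / 2) * ‖mFourierCoeff U n‖) M →
      (∀ n, HasSum (fun k => mFourierCoeff (U ^ 2 : C(Torus2, ℂ)) (n - k) *
        (((weight k ^ s : ℝ) : ℂ) * mFourierCoeff U k)) (W n)) →
      ∃ g : C(Torus2, ℂ), ‖g‖ ≤ C * K ^ 3 ∧ ∀ n, mFourierCoeff g n =
        ((weight n ^ s : ℝ) : ℂ) * mFourierCoeff (U ^ 3 : C(Torus2, ℂ)) n - 3 * W n := by
  have hσ : 0 < s / 2 := by linarith
  have hσ1 : s / 2 < 1 := by linarith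
  have hβ0 : 0 ≤ β := by linarith
  set c := subordinationConst (s / 2) with hc
  have hc0 : 0 < c := subordinationConst_pos hσ hσ1
  set m := 8 + 6 * ∫ z, (‖z‖ ^ β) ^ 2 ∂gaussian2 with hm
  have hm0 : 0 ≤ m := add_nonneg (by norm_num)
    (mul_nonneg (by norm_num) (integral_nonneg fun z => by positivity))
  have hρint := integrableOn_min_one_rpow_mul hσ hβ
  set ρ : ℝ → ℝ := fun t => min 1 (t ^ β) * t ^ (-1 - s / 2) with hρ
  refine ⟨c⁻¹ * (m * ∫ t in Set.Ioi 0, ρ t), mul_nonneg (inv_nonneg.2 hc0.le) (mul_nonneg hm0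
    (setIntegral_nonneg measurableSet_Ioi fun t ht => ?_)), ?_⟩
  · have := Set.mem_Ioi.1 ht
    positivity
  intro U K L M W hK hU hL hM hW
  have hK0 : 0 ≤ K := (norm_nonneg _).trans hK
  set G : ℝ → Torus2 → ℂ := fun t x => ((t ^ (-1 - s / 2) : ℝ) : ℂ) * heatCommutator U t x with hG
  have hGmeas : Measurable fun p : Torus2 × ℝ => G p.2 p.1 := by
    have := ((continuous_heatCommutator U).comp (continuous_swap (X := Torus2))).measurable
    refine Measurable.mul ?_ this
    fun_prop
  have hGbound (x : Torus2) (t : ℝ) (ht : 0 < t) : ‖G t x‖ ≤ m * K ^ 3 * ρ t := by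
    rw [hG, norm_mul, Complex.norm_real, Real.norm_of_nonneg (Real.rpow_nonneg ht.le _)]
    refine (mul_le_mul_of_nonneg_left (norm_heatCommutator_le hβ0 hβ1 hK hU ht x)
      (Real.rpow_nonneg ht.le _)).trans_eq ?_
    rw [hρ]; ring
  have hae (x : Torus2) : ∀ᵐ t ∂volume.restrict (Set.Ioi (0 : ℝ)), ‖G t x‖ ≤ m * K ^ 3 * ρ t :=
    (ae_restrict_iff' measurableSet_Ioi).2 (.of_forall (hGbound x))
  have hgcont : Continuous fun x => ∫ t in Set.Ioi (0 : ℝ), G t x := by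
    refine continuous_of_dominated (fun x => ?_) hae (hρint.const_mul _) (.of_forall fun t => ?_)
    · exact (hGmeas.comp measurable_prodMk_left).aestronglyMeasurable
    · exact continuous_const.mul (continuous_heatCommutator_right U t)
  refine ⟨⟨fun x => (c⁻¹ : ℝ) * ∫ t in Set.Ioi (0 : ℝ), G t x, by fun_prop⟩, ?_, fun n => ?_⟩
  · refine (ContinuousMap.norm_le _ ?_).2 fun x => ?_
    · refine mul_nonneg (mul_nonneg (inv_nonneg.2 hc0.le) (mul_nonneg hm0
        (setIntegral_nonneg measurableSet_Ioi fun t ht => ?_))) (pow_nonneg hK0 3)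
      have := Set.mem_Ioi.1 ht
      positivity
    · rw [ContinuousMap.coe_mk, norm_mul, Complex.norm_real,
        Real.norm_of_nonneg (inv_nonneg.2 hc0.le), mul_assoc]
      refine mul_le_mul_of_nonneg_left ?_ (inv_nonneg.2 hc0.le)
      refine (norm_integral_le_of_norm_le (hρint.const_mul _) (hae x)).trans_eq ?_
      rw [integral_const_mul]
      ring
  · have hint : Integrable (fun p : Torus2 × ℝ => mFourier (-n) p.1 * G p.2 p.1)
        (torusMeasure.prod (volume.restrict (Set.Ioi 0))) := by
      refine ((hρint.const_mul (m * K ^ 3)).comp_snd torusMeasure).mono' ?_ ?_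
      · exact (((mFourier (-n)).continuous.measurable.comp measurable_fst).mul
          hGmeas).aestronglyMeasurable
      · have h := Measure.quasiMeasurePreserving_snd (μ := torusMeasure)
          (ν := volume.restrict (Set.Ioi (0 : ℝ)))
        filter_upwards [h.ae (ae_restrict_mem measurableSet_Ioi)] with p hp
        rw [norm_mul, norm_mFourier_apply, one_mul]
        exact hGbound p.1 p.2 hp
    have hcoeff (t : ℝ) : ∫ x, mFourier (-n) x * G t x ∂torusMeasure =
        ((t ^ (-1 - s / 2) : ℝ) : ℂ) * mFourierCoeff (heatCommutator U t) n := by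
      rw [mFourierCoeff_eq_integral_torusMeasure, ← integral_const_mul]
      simp only [hG, mul_left_comm]
    have hI1 : IntegrableOn (fun t : ℝ => ((t ^ (-1 - s / 2) : ℝ) : ℂ) *
        mFourierCoeff (heatCommutator U t) n) (Set.Ioi 0) := by
      have h := hint.integral_prod_right
      simp only [hcoeff] at h
      exact h
    have hexp (k : Fin 2 → ℤ) : IntegrableOn (fun t : ℝ =>
        (1 - Real.exp (-(t * weight k ^ 2))) * t ^ (-1 - s / 2)) (Set.Ioi 0) :=
      integrableOn_one_sub_exp_mul_rpow hσ hσ1 (sq_nonneg _)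
    have hexpI (k : Fin 2 → ℤ) : ∫ t in Set.Ioi (0 : ℝ),
        (1 - Real.exp (-(t * weight k ^ 2))) * t ^ (-1 - s / 2) = weight k ^ s * c := by
      rw [integral_one_sub_exp_mul_rpow _ (pow_pos (weight_pos k) 2), ← Real.rpow_natCast,
        ← Real.rpow_mul (weight_pos k).le]
      congr 2
      push_cast
      ring
    set F : (Fin 2 → ℤ) → ℝ → ℂ := fun k t =>
      (((1 - Real.exp (-(t * weight k ^ 2))) * t ^ (-1 - s / 2) : ℝ) : ℂ) *
        (mFourierCoeff (U ^ 2 : C(Torus2, ℂ)) (n - k) * mFourierCoeff U k) with hF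
    have hFint (k : Fin 2 → ℤ) : Integrable (F k) (volume.restrict (Set.Ioi 0)) :=
      Integrable.mul_const (hexp k).ofReal _
    have hFnorm (k : Fin 2 → ℤ) : ∫ t in Set.Ioi (0 : ℝ), ‖F k t‖ =
        c * (‖mFourierCoeff (U ^ 2 : C(Torus2, ℂ)) (n - k)‖ * (weight k ^ s * ‖mFourierCoeff U k‖)) := by
      have e : ∫ t in Set.Ioi (0 : ℝ), ‖F k t‖ = ∫ t in Set.Ioi (0 : ℝ),
          (1 - Real.exp (-(t * weight k ^ 2))) * t ^ (-1 - s / 2) *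
          (‖mFourierCoeff (U ^ 2 : C(Torus2, ℂ)) (n - k)‖ * ‖mFourierCoeff U k‖) := by
        refine setIntegral_congr_fun measurableSet_Ioi fun t ht => ?_
        have ht0 : 0 ≤ t := le_of_lt ht
        simp only [hF]
        rw [norm_mul, norm_mul (mFourierCoeff _ _), Complex.norm_real, Real.norm_of_nonneg
          (mul_nonneg (one_sub_exp_neg_mul_nonneg ht0 (sq_nonneg _)) (Real.rpow_nonneg ht0 _))]
      rw [e, integral_mul_const, hexpI]
      ring
    -- Sum and time integral may be exchanged: as `1 - e^{-tλ} ≥ 0`, the integrals of the norms are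
    -- exactly `c` times the terms of the absolutely convergent series for `u² Λu`.
    have hFsum := hasSum_integral_of_summable_integral_norm hFint (by
      simp only [hFnorm]
      exact (summable_conv_weight hσ.le hL (by simpa only [sub_half] using hM) n).1.mul_left c)
    have hFI (k : Fin 2 → ℤ) : ∫ t in Set.Ioi (0 : ℝ), F k t =
        c * (mFourierCoeff (U ^ 2 : C(Torus2, ℂ)) (n - k) * (((weight k ^ s : ℝ) : ℂ) * mFourierCoeff U k)) := by
      rw [integral_mul_const, integral_complex_ofReal, hexpI]
      push_cast
      ring
    simp only [hFI] at hFsum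
    have hcW := hFsum.unique ((hW n).mul_left (c : ℂ))
    have hFt : ∫ t in Set.Ioi (0 : ℝ), ∑' k, F k t = ∫ t in Set.Ioi (0 : ℝ), 3⁻¹ *
        ((((1 - Real.exp (-(t * weight n ^ 2))) * t ^ (-1 - s / 2) : ℝ) : ℂ) *
          mFourierCoeff (U ^ 3 : C(Torus2, ℂ)) n -
          ((t ^ (-1 - s / 2) : ℝ) : ℂ) * mFourierCoeff (heatCommutator U t) n) := by
      refine setIntegral_congr_fun measurableSet_Ioi fun t ht => ?_
      have h := (hasSum_mFourierCoeff_heatCommutator U (le_of_lt ht) n).mul_left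
        ((t ^ (-1 - s / 2) : ℝ) : ℂ)
      refine Eq.trans (tsum_congr fun k => ?_) (h.tsum_eq.trans ?_)
      · simp only [hF]; push_cast; ring
      · push_cast; ring
    have hI2 : IntegrableOn (fun t : ℝ =>
        (((1 - Real.exp (-(t * weight n ^ 2))) * t ^ (-1 - s / 2) : ℝ) : ℂ) *
          mFourierCoeff (U ^ 3 : C(Torus2, ℂ)) n) (Set.Ioi 0) :=
      Integrable.mul_const (hexp n).ofReal _
    rw [hFt, integral_const_mul, integral_sub hI2 hI1,
      integral_mul_const, integral_complex_ofReal, hexpI] at hcW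
    rw [mFourierCoeff_eq_integral_torusMeasure]
    simp only [ContinuousMap.coe_mk, mul_left_comm (mFourier (-n) _)]
    rw [integral_const_mul]
    simp only [← integral_const_mul (mFourier (-n) _)]
    rw [integral_integral_swap hint]
    simp only [hcoeff]
    have hc' : (c : ℂ) ≠ 0 := by exact_mod_cast hc0.ne'
    push_cast at hcW ⊢
    rw [inv_mul_eq_iff_eq_mul₀ hc']
    linear_combination (-3 : ℂ) * hcW

/-! ### The two ranges of `s` and the conclusion. -/

/-- The bound of the commutator for `s ≤ 8/5`, by the heat semigroup. -/
theorem exists_commutator_bound_of_le {s α : ℝ} (hs : 0 < s) (hs' : s ≤ 8 / 5)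
    (hα : 3 / 4 * s < α) :
    ∃ C : ℝ, 0 ≤ C ∧ ∀ (A : ℝ) (U : C(Torus2, ℂ)) (V : ℕ → C(Torus2, ℂ)) (W : (Fin 2 → ℤ) → ℂ),
      DyadicSum 2 α A U V →
      (∀ n, HasSum (fun k => mFourierCoeff (U ^ 2 : C(Torus2, ℂ)) (n - k) *
        (((weight k ^ s : ℝ) : ℂ) * mFourierCoeff U k)) (W n)) →
      ∃ g : Torus2 → ℂ, MemLp g 2 torusMeasure ∧ (∀ n, mFourierCoeff g n =
        ((weight n ^ s : ℝ) : ℂ) * mFourierCoeff (U ^ 3 : C(Torus2, ℂ)) n - 3 * W n) ∧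
        eLpNorm g 2 torusMeasure ≤ ENNReal.ofReal (C * A ^ 3) := by
  -- The Hölder exponent `β = 3s/5` lies strictly between `s/2` and `3s/4 < α`, and is at most
  -- `24/25` when `s ≤ 8/5`.
  obtain ⟨C, hC, h⟩ := exists_commutator_of_holder hs (by linarith)
    (by linarith : s / 2 < 3 / 5 * s) (by linarith)
  have hα0 : 0 < α := by linarith
  set κ : ℝ := max (1 - 2 ^ (-α))⁻¹
    (2 * (4 * Real.pi * (2 : ℕ)) ^ (3 / 5 * s) * (1 - 2 ^ (-(α - 3 / 5 * s)))⁻¹) with hκ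
  have hκ0 : 0 ≤ κ := le_max_of_le_left (inv_nonneg.2 (one_sub_two_rpow_pos hα0).le)
  refine ⟨C * κ ^ 3, by positivity, fun A U V W hV hW => ?_⟩
  have hA := hV.nonneg
  obtain ⟨V', hV'⟩ := hV.exists_sq hα0
  obtain ⟨g, hg, hgn⟩ := h U (κ * A) _ _ W
    ((hV.norm_le_mul hα0).trans (by rw [mul_comm]; gcongr; exact le_max_left _ _))
    (fun x y => (hV.holder (β := 3 / 5 * s) (by linarith) (by linarith) (by linarith) x y).trans
      (by gcongr; exact le_max_right _ _))
    (hV'.sqSumLE (by norm_num) (by linarith) (by linarith : s / 2 < α))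
    (hV.sqSumLE (by norm_num) (by linarith) (by linarith : s / 2 < α)) hW
  have hbound (x : Torus2) : ‖g x‖ ≤ C * (κ * A) ^ 3 := (g.norm_coe_le_norm x).trans hg
  refine ⟨g, MemLp.of_bound g.continuous.aestronglyMeasurable _ (.of_forall hbound), hgn, ?_⟩
  refine (eLpNorm_le_of_ae_bound (.of_forall hbound)).trans_eq ?_
  rw [measure_univ, ENNReal.one_rpow, one_mul]
  ring_nf

/-- The bound of the commutator for `s ≥ 8/5`, by absolute values of the Fourier coefficients. -/
theorem exists_commutator_bound_of_ge {s α : ℝ} (hs : 8 / 5 ≤ s) (hα : s - 1 / 4 < α) :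
    ∃ C : ℝ, 0 ≤ C ∧ ∀ (A : ℝ) (U : C(Torus2, ℂ)) (V : ℕ → C(Torus2, ℂ)) (W : (Fin 2 → ℤ) → ℂ),
      DyadicSum 2 α A U V →
      (∀ n, HasSum (fun k => mFourierCoeff (U ^ 2 : C(Torus2, ℂ)) (n - k) *
        (((weight k ^ s : ℝ) : ℂ) * mFourierCoeff U k)) (W n)) →
      ∃ g : Torus2 → ℂ, MemLp g 2 torusMeasure ∧ (∀ n, mFourierCoeff g n =
        ((weight n ^ s : ℝ) : ℂ) * mFourierCoeff (U ^ 3 : C(Torus2, ℂ)) n - 3 * W n) ∧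
        eLpNorm g 2 torusMeasure ≤ ENNReal.ofReal (C * A ^ 3) := by
  have hα0 : 0 < α := by linarith
  -- The loss `29/100` exceeds `1/4`, so `r < α`, yet is small enough that `4r - 2s = 2s - 1.16 > 2`
  -- for `s ≥ 8/5`; this makes `⟨2πn⟩^{s-2r}` square summable on `ℤ²`.
  obtain ⟨r, hr⟩ : ∃ r, r = s - 29 / 100 := ⟨_, rfl⟩
  have hrα : r < α := by linarith
  have hr0 : 0 ≤ r := by linarith
  have hZ : SqSumLE (fun n => weight n ^ (s - 2 * r))
      √(∑' n, (weight n ^ (s - 2 * r)) ^ 2) := by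
    refine SqSumLE.of_summable ((summable_weight_rpow (q := 4 * r - 2 * s) (by linarith)).congr
      fun n => ?_)
    rw [← Real.rpow_mul_natCast (weight_pos n).le]
    congr 1
    push_cast
    ring
  set Z := √(∑' n, (weight n ^ (s - 2 * r)) ^ 2)
  set κ : ℝ := (10 * (2 : ℕ)) ^ r * (1 - 2 ^ (-(α - r)))⁻¹
  -- The degree constant is `2 * 2` because squaring doubles the degrees of the blocks.
  set μ : ℝ := (10 * (2 * 2 : ℕ)) ^ r * (1 - 2 ^ (-(α - r)))⁻¹ * (2 * (1 - 2 ^ (-α))⁻¹)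
  have hq := one_sub_two_rpow_pos hα0
  have hq' := one_sub_two_rpow_pos (sub_pos.2 hrα)
  have hZ0 : 0 ≤ Z := Real.sqrt_nonneg _
  refine ⟨(s * 2 ^ (s - 1) + 1) * (2 * (μ * κ * Z)) +
    (s * 2 ^ (s - 1) + 1) * (2 * (κ * κ * Z)) * (κ * Z), by positivity,
    fun A U V W hV hW => ?_⟩
  have hA := hV.nonneg
  obtain ⟨V', hV'⟩ := hV.exists_sq hα0
  have hsq := sqSumLE_cubic_commutator (by linarith) (by linarith) (by linarith) (by linarith)
    (hV.sqSumLE (by norm_num) hr0 hrα) (hV'.sqSumLE (by norm_num) hr0 hrα) hZ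
    (fun n => by simpa only [sq] using hasSum_mFourierCoeff_mul U U n)
    (fun n => hasSum_mFourierCoeff_mul (U ^ 2) U n) hW
  rw [← pow_succ] at hsq
  obtain ⟨g, hg, hgn, hgle⟩ := exists_memLp_mFourierCoeff_eq _ hsq.1 hsq.2
  refine ⟨g, hg, hgn, hgle.trans_eq ?_⟩
  congr 1
  ring

/-- The constant `C` depends only on `s`, `ε` and the bump function `φ` that fixes the norm. As
`s - ε > 0`, an element `u` of `C^{s-ε}` is (given by) a unique continuous function `U`, whose
pointwise powers are `u²` and `u³`; the distribution `w` is the product `u² ⟨∇⟩^s u`; and `g` is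
the function `⟨∇⟩^s(u³) - 3 u² ⟨∇⟩^s u` of class `L²`. -/
theorem mainTheorem4 (φ : ℝ → ℝ) (hφ : IsLPBump φ) (s ε : ℝ) (hs : 0 < s) (hε : 0 < ε)
    (hεs : ε < 1 / 4 * min s 1) :
    ∃ C : ℝ≥0, ∀ u : TorusDistribution, besovHolderNorm φ (s - ε) u < ⊤ →
      ∃ U : C(Torus2, ℂ), ofContinuous U = u ∧
        ∃ w : TorusDistribution, IsProduct (ofContinuous (U ^ 2)) (bracketNabla s u) w ∧
          ∃ g : Torus2 → ℂ, MemLp g 2 torusMeasure ∧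
            (∀ n, UnitAddTorus.mFourierCoeff g n =
              distCoeff (bracketNabla s (ofContinuous (U ^ 3)) - (3 : ℂ) • w) n) ∧
            eLpNorm g 2 torusMeasure ≤ C * besovHolderNorm φ (s - ε) u ^ 3 := by
  have hε1 : ε < 1 / 4 * s := hεs.trans_le (by gcongr; exact min_le_left _ _)
  have hε2 : ε < 1 / 4 := hεs.trans_le (by linarith [min_le_right s 1])
  obtain ⟨C, hC, hbound⟩ : ∃ C : ℝ, 0 ≤ C ∧ ∀ (A : ℝ) (U : C(Torus2, ℂ)) (V : ℕ → C(Torus2, ℂ))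
      (W : (Fin 2 → ℤ) → ℂ), DyadicSum 2 (s - ε) A U V →
      (∀ n, HasSum (fun k => UnitAddTorus.mFourierCoeff (U ^ 2 : C(Torus2, ℂ)) (n - k) *
        (((weight k ^ s : ℝ) : ℂ) * UnitAddTorus.mFourierCoeff U k)) (W n)) →
      ∃ g : Torus2 → ℂ, MemLp g 2 torusMeasure ∧ (∀ n, UnitAddTorus.mFourierCoeff g n =
        ((weight n ^ s : ℝ) : ℂ) * UnitAddTorus.mFourierCoeff (U ^ 3 : C(Torus2, ℂ)) n -
          3 * W n) ∧
        eLpNorm g 2 torusMeasure ≤ ENNReal.ofReal (C * A ^ 3) := by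
    -- The first range uses `ε < s/4`, that is `3s/4 < s - ε`; the second uses `ε < 1/4`.
    rcases le_total s (8 / 5) with h | h
    · exact exists_commutator_bound_of_le hs h (by linarith)
    · exact exists_commutator_bound_of_ge h (by linarith)
  refine ⟨C.toNNReal, fun u hu => ?_⟩
  have hα : 0 < s - ε := by linarith
  obtain ⟨U, rfl, V, hV⟩ := exists_dyadicSum_of_besovHolderNorm_lt_top hφ hα hu
  obtain ⟨V', hV'⟩ := hV.exists_sq hα
  obtain ⟨w, hw⟩ := exists_isProduct_bracketNabla (f := ofContinuous (U ^ 2))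
    (u := ofContinuous U) hs.le
    (hV'.sqSumLE (by norm_num) (by linarith) (by linarith : s / 2 < s - ε))
    (hV.sqSumLE (by norm_num) (by linarith) (by linarith : s / 2 < s - ε))
  obtain ⟨g, hg, hgn, hgle⟩ := hbound _ U V (distCoeff w) hV hw
  refine ⟨U, rfl, w, hw, g, hg, hgn, hgle.trans_eq ?_⟩
  rw [ENNReal.ofReal_mul hC, ENNReal.ofReal_pow ENNReal.toReal_nonneg,
    ENNReal.ofReal_toReal hu.ne]
  rfl
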